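/- Let $1\le K\le N$ and $L$ be integers, let $f_1,\dots,f_K\in[0,1)$ be distinct, let $A\in\mathbb{C}^{N\times K}$ be the Vandermonde matrix with entries $A_{nk}=e^{i2\pi(n-1)f_k}$, and let $S\in\mathbb{C}^{K\times L}$ be a fixed matrix such that $\widehat\Sigma=\frac1L SS^H$ is positive definite. Let $\sigma\ge 0$ and $Y=AS+E$, where the entries of the random matrix $E\in\mathbb{C}^{N\times L}$ are i.i.d. (circularly symmetric) complex Gaussian with mean zero and variance $\sigma^2$. Let the columns of $U\in\mathbb{C}^{N\times K}$ form an orthonormal basis of the signal subspace, i.e. of the column space of $A$ (equivalently, of $AS$), and let the columns of $\widehat U\in\mathbb{C}^{N\times K}$ be orthonormal eigenvectors of $\widehat R=\frac1L YY^H$ associated with its $K$ greatest eigenvalues. Let $\mathrm{dist}(\widehat U,U)=\|\sin\Theta(\widehat U,U)\|$, where $\Theta(\widehat U,U)$ is the diagonal matrix of the canonical angles $\theta_j=\arccos\sigma_j(\widehat U^HU)$, $j=1,\dots,K$, and $\sin\Theta$ is the diagonal matrix with entries $\sin\theta_j$. Here $\|\cdot\|$ is the spectral norm, and $\sigma_j(\cdot)$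 and $\lambda_j(\cdot)$ are the $j$th greatest singular value and eigenvalue. If $$B:=\frac{12\,\sigma\,\|A\|\,\|\widehat\Sigma\|^{1/2}\sqrt{N/L}+16\,\sigma^2\max\{\sqrt{N/L},\,N/L\}}{\sigma_K^2(A)\,\lambda_K(\widehat\Sigma)}<0.586,$$ then, with probability at least $1-3e^{-N/2}$, $$\mathrm{dist}(\widehat U,U)\le B.$$ -/

import Mathlib

open MeasureTheory ProbabilityTheory
open scoped Matrix Matrix.Norms.L2Operator ComplexOrder

noncomputable section

namespace Esprit

/-- The `N × K` array manifold (Vandermonde) matrix: with rows indexed from `0`, its entry in row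
`n` and column `k` is `exp (i 2 π n f_k)`. -/
def manifold (N : ℕ) {K : ℕ} (f : Fin K → ℝ) : Matrix (Fin N) (Fin K) ℂ :=
  Matrix.of fun n k => Complex.exp (Complex.I * 2 * Real.pi * (n : ℕ) * f k)

/-- The sample covariance matrix `L⁻¹ X Xᴴ` of the `L` columns (snapshots) of `X`. -/
def sampleCov {m L : ℕ} (X : Matrix (Fin m) (Fin L) ℂ) : Matrix (Fin m) (Fin m) ℂ :=
  (1 / (L : ℂ)) • (X * Xᴴ)

/-- The `j`th greatest singular value of a matrix, `j = 1, 2, …` (zero when `j` exceeds the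
number of columns). -/
def singularValue {m n : ℕ} (X : Matrix (Fin m) (Fin n) ℂ) (j : ℕ) : ℝ :=
  (Matrix.toEuclideanLin X).singularValues (j - 1)

/-- The eigenvalues of a Hermitian matrix in descending order: the entry at the zero-based index
`j` is the `(j+1)`st greatest one. -/
def eigenvalueDesc {n : ℕ} {M : Matrix (Fin n) (Fin n) ℂ} (hM : M.IsHermitian) (j : Fin n) : ℝ :=
  hM.eigenvalues₀ (Fin.cast (Fintype.card_fin n).symm j)

/-- `U` consists of the first `K` eigenvectors in some eigen-decomposition
`M = ∑ j, l j • u_j u_jᴴ` of `M` with orthonormal eigenvectors (the columns of the unitary `V`) and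
eigenvalues `l` sorted in descending order. -/
def IsLeadingEigenvectors {N K : ℕ} (M : Matrix (Fin N) (Fin N) ℂ)
    (U : Matrix (Fin N) (Fin K) ℂ) : Prop :=
  ∃ (hKN : K ≤ N) (V : Matrix (Fin N) (Fin N) ℂ) (l : Fin N → ℝ),
    V ∈ Matrix.unitaryGroup (Fin N) ℂ ∧ Antitone l ∧
      M = V * Matrix.diagonal (fun j => (l j : ℂ)) * Vᴴ ∧
      U = V.submatrix id (Fin.castLE hKN)

/-- The columns of `U` form an orthonormal basis of the column space of `A`. -/
def IsOrthonormalBasisOfRange {N K : ℕ} (A U : Matrix (Fin N) (Fin K) ℂ) : Prop :=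
  Uᴴ * U = 1 ∧ LinearMap.range U.mulVecLin = LinearMap.range A.mulVecLin

/-- The canonical angles `θ_j = arccos σ_j(Ûᴴ U)` between the column spaces of two isometric
matrices, with `j` zero-based. -/
def canonicalAngle {N r : ℕ} (Uhat U : Matrix (Fin N) (Fin r) ℂ) (j : Fin r) : ℝ :=
  Real.arccos (singularValue (Uhatᴴ * U) (j + 1))

/-- The subspace distance `‖sin Θ(Û, U)‖` (spectral norm of the diagonal matrix of the sines of the
canonical angles). -/
def subspaceDist {N r : ℕ} (Uhat U : Matrix (Fin N) (Fin r) ℂ) : ℝ :=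
  ‖(Matrix.diagonal fun j => Real.sin (canonicalAngle Uhat U j) : Matrix (Fin r) (Fin r) ℝ)‖

/-- The (circularly symmetric) complex Gaussian distribution with mean zero and variance `σ ^ 2`:
real and imaginary parts are independent, each `N(0, σ ^ 2 / 2)`. -/
def complexGaussian (σ : ℝ) : Measure ℂ :=
  ((gaussianReal 0 (Real.toNNReal (σ ^ 2 / 2))).prod
    (gaussianReal 0 (Real.toNNReal (σ ^ 2 / 2)))).map Complex.measurableEquivRealProd.symm

/-- The entries of the random matrix `E` are i.i.d. complex Gaussian with mean zero and variance
`σ ^ 2`. -/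
def IsIIDComplexGaussian {Ω : Type*} [MeasurableSpace Ω] (μ : Measure Ω) {N L : ℕ} (σ : ℝ)
    (E : Ω → Matrix (Fin N) (Fin L) ℂ) : Prop :=
  iIndepFun (fun (p : Fin N × Fin L) ω => E ω p.1 p.2) μ ∧
    ∀ n l, HasLaw (fun ω => E ω n l) (complexGaussian σ) μ

/-- The property `P` holds with probability at least `p`: it holds on a measurable event of
probability at least `p`. -/
def WithProbAtLeast {Ω : Type*} [MeasurableSpace Ω] (μ : Measure Ω) (p : ℝ) (P : Ω → Prop) : Prop :=
  ∃ G : Set Ω, MeasurableSet G ∧ p ≤ μ.real G ∧ ∀ ω ∈ G, P ω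

/-- The error bound
`(12 σ ‖A‖ ‖Σ̂‖^(1/2) √(N/L) + 16 σ² max {√(N/L), N/L}) / (σ_K(A)² λ_K(Σ̂))`,
where `Σ̂ = L⁻¹ S Sᴴ` is positive definite. -/
def errorBound {N K L : ℕ} (hK : 1 ≤ K) (A : Matrix (Fin N) (Fin K) ℂ)
    (S : Matrix (Fin K) (Fin L) ℂ) (hS : (sampleCov S).PosDef) (σ : ℝ) : ℝ :=
  (12 * σ * ‖A‖ * ‖sampleCov S‖ ^ (1 / 2 : ℝ) * √((N : ℝ) / L)
      + 16 * σ ^ 2 * max √((N : ℝ) / L) ((N : ℝ) / L))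
    / (singularValue A K ^ 2
        * eigenvalueDesc hS.isHermitian ⟨K - 1, Nat.sub_one_lt_of_lt hK⟩)

end Esprit

end

namespace Esprit

/-! Write `R̂ = A Σ̂ Aᴴ + D + σ² I`, where `D` collects the cross terms and the centred noise
covariance, `L⁻¹ (A S Eᴴ + (A S Eᴴ)ᴴ + (E Eᴴ - σ² L I))`. Shifting by `σ² I` does not move
eigenvectors, so everything reduces to a bound `‖D‖ ≤ η` with `B = 2 η / δ`, `δ = σ_K(A)² λ_K(Σ̂)`.

Deterministic part (`norm_tailProj_mul_le`, a sin-theta argument). Let `P` be the spectral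
projection of `R̂` beyond its first `K` eigenvectors, and write `A Σ̂ Aᴴ = U G Uᴴ` with `G ≥ δ`.
Since `P` commutes with `R̂`, `P U G = T (P U) - P D U` with `T = P (R̂ - σ² I)`, and Weyl's
inequality gives `‖T‖ ≤ ‖D‖`. Hence `(δ - η) ‖P U‖ ≤ η`; as soon as `2 η ≤ δ`, that is `B ≤ 1`, this
yields `‖P U‖ ≤ 2 η / δ`, and `‖P U‖` dominates every `sin θ_j`.

Probabilistic part (`measure_hasDominantEigenvalueGE_le`). Averaging over a Gaussian direction `x`
plays the role of an ε-net: if the top eigenvalue of `H` dominates the spectrum and is at least `2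
a`, then `xᴴ H x ≥ a ‖x‖²` with probability at least `4⁻ⁿ` over `x`. Fubini and Markov's inequality
turn a bound `C` on the exponential moments along fixed unit directions into the tail bound `4ⁿ C
exp (-s a)`. This is applied to `± (E Eᴴ - L I)` and to `S Eᴴ E Sᴴ` at `σ = 1`; each fails with
probability at most `exp (-N / 2)`, whence the factor 3. -/

/-! ### Complex Gaussian vectors and their invariance. -/

instance isProbabilityMeasure_complexGaussian (σ : ℝ) :
    IsProbabilityMeasure (complexGaussian σ) := by
  unfold complexGaussian
  exact Measure.isProbabilityMeasure_map Complex.measurableEquivRealProd.symm.measurable.aemeasurable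

theorem charFun_complexGaussian (σ : ℝ) (t : ℂ) :
    charFun (complexGaussian σ) t = Complex.exp (-(σ ^ 2 * ‖t‖ ^ 2 / 4 : ℝ)) := by
  have key : ∀ u : ℝ, ∫ x : ℝ, Complex.exp (u * x * Complex.I)
      ∂(gaussianReal 0 (Real.toNNReal (σ ^ 2 / 2))) = Complex.exp (-(σ ^ 2 * u ^ 2 / 4 : ℝ)) := by
    intro u
    have h := charFun_gaussianReal (μ := 0) (v := Real.toNNReal (σ ^ 2 / 2)) u
    rw [charFun_apply_real] at h
    rw [h]
    congr 1
    have : ((Real.toNNReal (σ ^ 2 / 2) : ℝ) : ℂ) = (σ ^ 2 / 2 : ℝ) := by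
      rw [Real.coe_toNNReal _ (by positivity)]
    rw [this]
    push_cast
    ring
  unfold complexGaussian
  rw [charFun_apply, integral_map_equiv]
  have : ∀ p : ℝ × ℝ, Complex.exp (inner ℝ (Complex.measurableEquivRealProd.symm p) t * Complex.I)
      = Complex.exp (t.re * p.1 * Complex.I) * Complex.exp (t.im * p.2 * Complex.I) := by
    intro p
    rw [← Complex.exp_add]
    congr 1
    simp [Complex.measurableEquivRealProd, Complex.inner]
    ring
  simp_rw [this]
  rw [integral_prod_mul (fun x : ℝ => Complex.exp (t.re * x * Complex.I))
    (fun x : ℝ => Complex.exp (t.im * x * Complex.I)), key, key, ← Complex.exp_add]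
  congr 1
  rw [Complex.sq_norm, Complex.normSq_apply]
  push_cast
  ring

/-- The law of a random vector with i.i.d. circularly symmetric complex Gaussian entries. -/
noncomputable def complexGaussianPi (ι : Type*) [Fintype ι] (σ : ℝ) : Measure (ι → ℂ) :=
  Measure.pi fun _ => complexGaussian σ

instance isProbabilityMeasure_complexGaussianPi (ι : Type*) [Fintype ι] (σ : ℝ) :
    IsProbabilityMeasure (complexGaussianPi ι σ) := by
  unfold complexGaussianPi; infer_instance

theorem charFun_complexGaussianPi {ι : Type*} [Fintype ι] (σ : ℝ) (t : PiLp 2 fun _ : ι => ℂ) :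
    charFun ((complexGaussianPi ι σ).map (WithLp.toLp 2)) t
      = Complex.exp (-(σ ^ 2 * (∑ i, ‖t i‖ ^ 2) / 4 : ℝ)) := by
  unfold complexGaussianPi
  rw [charFun_pi]
  simp_rw [charFun_complexGaussian, ← Complex.exp_sum]
  congr 1
  rw [Finset.mul_sum, Finset.sum_div]
  push_cast
  rw [Finset.sum_neg_distrib]

theorem real_inner_eq_re_star_dotProduct {ι : Type*} [Fintype ι] (x y : PiLp 2 fun _ : ι => ℂ) :
    inner ℝ x y = (star (WithLp.ofLp x) ⬝ᵥ WithLp.ofLp y).re := by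
  rw [PiLp.inner_apply]
  simp [dotProduct, Complex.inner, mul_comm]

theorem star_dotProduct_self {ι : Type*} [Fintype ι] (x : ι → ℂ) :
    star x ⬝ᵥ x = ((∑ i, ‖x i‖ ^ 2 : ℝ) : ℂ) := by
  simp only [dotProduct, Pi.star_apply, RCLike.star_def, Complex.conj_mul', Complex.ofReal_sum,
    Complex.ofReal_pow]

/-- A co-isometry, scaled by `c`, maps a complex Gaussian vector to a complex Gaussian vector. -/
theorem map_mulVec_complexGaussianPi {ι κ : Type*} [Fintype ι] [Fintype κ] [DecidableEq ι]
    (M : Matrix ι κ ℂ) (c σ : ℝ) (hM : M * Mᴴ = ((c ^ 2 : ℝ) : ℂ) • (1 : Matrix ι ι ℂ)) :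
    (complexGaussianPi κ σ).map (fun g => M *ᵥ g) = complexGaussianPi ι (c * σ) := by
  have hcont : Continuous fun g : κ → ℂ => M *ᵥ g := Continuous.matrix_mulVec continuous_const
    continuous_id
  unfold complexGaussianPi
  have : IsProbabilityMeasure ((Measure.pi fun _ : κ => complexGaussian σ).map (fun g => M *ᵥ g)) :=
    Measure.isProbabilityMeasure_map hcont.measurable.aemeasurable
  -- Characteristic functions determine the law. The adjoint moves `M` onto `t`, and `M Mᴴ = c² I`
  -- gives `‖Mᴴ t‖² = c² ‖t‖²`.
  refine charFun_eq_pi_iff.1 fun t => ?_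
  have hR : ∏ i, charFun (complexGaussian (c * σ)) (t i)
      = Complex.exp (-((c * σ) ^ 2 * (∑ i, ‖t i‖ ^ 2) / 4 : ℝ)) := by
    rw [← charFun_complexGaussianPi, complexGaussianPi, charFun_pi]
  rw [hR, Measure.map_map (by fun_prop) hcont.measurable, charFun_apply,
    integral_map (by fun_prop) (by fun_prop)]
  have h1 := charFun_complexGaussianPi σ (WithLp.toLp 2 (Mᴴ *ᵥ (WithLp.ofLp t)))
  rw [charFun_apply, integral_map (by fun_prop) (by fun_prop)] at h1
  have hin : ∀ g : κ → ℂ, inner ℝ (((WithLp.toLp 2) ∘ fun g => M *ᵥ g) g) t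
      = inner ℝ (WithLp.toLp 2 g) (WithLp.toLp 2 (Mᴴ *ᵥ (WithLp.ofLp t)) : PiLp 2 fun _ : κ => ℂ) := by
    intro g
    rw [real_inner_eq_re_star_dotProduct, real_inner_eq_re_star_dotProduct]
    simp only [Function.comp]
    rw [Matrix.star_mulVec, Matrix.dotProduct_mulVec]
  simp_rw [hin]
  unfold complexGaussianPi at h1
  rw [h1]
  congr 3
  have h2 : ((∑ i, ‖(Mᴴ *ᵥ (WithLp.ofLp t)) i‖ ^ 2 : ℝ) : ℂ) = ((c ^ 2 * ∑ i, ‖t i‖ ^ 2 : ℝ) : ℂ) := by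
    rw [← star_dotProduct_self, Matrix.star_mulVec, Matrix.conjTranspose_conjTranspose,
      Matrix.dotProduct_mulVec, Matrix.vecMul_vecMul, hM, Matrix.vecMul_smul, Matrix.vecMul_one,
      smul_dotProduct, star_dotProduct_self]
    simp
  have h3 : (∑ i, ‖(Mᴴ *ᵥ (WithLp.ofLp t)) i‖ ^ 2 : ℝ) = (c ^ 2 * ∑ i, ‖t i‖ ^ 2 : ℝ) := by
    exact_mod_cast h2
  simp only [h3]
  ring

/-! ### Radial law, tails and exponential moments. -/

theorem lintegral_complexGaussian_one {f : ℂ → ENNReal} (hf : Measurable f) :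
    ∫⁻ z, f z ∂(complexGaussian 1)
      = ∫⁻ z, ENNReal.ofReal (Real.pi⁻¹ * Real.exp (-‖z‖ ^ 2)) * f z := by
  have hv : Real.toNNReal ((1 : ℝ) ^ 2 / 2) ≠ 0 := by
    simp
  have hv' : ((Real.toNNReal ((1 : ℝ) ^ 2 / 2) : NNReal) : ℝ) = 1 / 2 := by
    rw [Real.coe_toNNReal _ (by positivity)]; norm_num
  unfold complexGaussian
  rw [gaussianReal_of_var_ne_zero _ hv, prod_withDensity (by fun_prop) (by fun_prop),
    lintegral_map_equiv, lintegral_withDensity_eq_lintegral_mul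
      (g := fun p => f (Complex.measurableEquivRealProd.symm p)) _ (by fun_prop)
      (hf.comp Complex.measurableEquivRealProd.symm.measurable),
    ← (Complex.volume_preserving_equiv_real_prod.symm).lintegral_comp_emb
      Complex.measurableEquivRealProd.symm.measurableEmbedding]
  refine lintegral_congr fun p => ?_
  simp only [Pi.mul_apply, gaussianPDF]
  congr 1
  rw [← ENNReal.ofReal_mul (gaussianPDFReal_nonneg _ _ _)]
  congr 1
  rw [gaussianPDFReal, gaussianPDFReal, hv', mul_mul_mul_comm, ← Real.exp_add, ← mul_inv,
    Real.mul_self_sqrt (by positivity), Complex.sq_norm, Complex.normSq_apply]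
  simp [Complex.measurableEquivRealProd]
  ring_nf

/-- Polar coordinates: the angle contributes `2 π` against the density `π⁻¹ exp (-|z|²)`. Thus
`|z|²` is standard exponential, which gives the moments and tails below. -/
theorem lintegral_norm_complexGaussian_one {F : ℝ → ENNReal} (hF : Measurable F) :
    ∫⁻ z, F ‖z‖ ∂(complexGaussian 1)
      = ∫⁻ r in Set.Ioi (0 : ℝ), ENNReal.ofReal (2 * r * Real.exp (-r ^ 2)) * F r := by
  rw [lintegral_complexGaussian_one (by fun_prop), ← Complex.lintegral_comp_polarCoord_symm]
  simp only [Complex.norm_polarCoord_symm, polarCoord_target]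
  rw [Measure.volume_eq_prod, setLIntegral_prod _ (by fun_prop)]
  refine setLIntegral_congr_fun measurableSet_Ioi fun r hr => ?_
  have hr' : 0 < r := hr
  simp only [setLIntegral_const, Real.volume_Ioo, abs_of_pos hr', smul_eq_mul]
  rw [mul_comm, ← mul_assoc, ← mul_assoc, ← ENNReal.ofReal_mul (by linarith [Real.pi_pos]),
    ← ENNReal.ofReal_mul (mul_nonneg (by linarith [Real.pi_pos]) hr'.le)]
  congr 2
  have := Real.pi_ne_zero
  field_simp
  ring

theorem lintegral_Ioi_mul_exp_neg_mul_sq {b : ℝ} (hb : 0 < b) {R : ℝ} (hR : 0 ≤ R) :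
    ∫⁻ r in Set.Ioi R, ENNReal.ofReal (2 * r * Real.exp (-b * r ^ 2))
      = ENNReal.ofReal (Real.exp (-b * R ^ 2) / b) := by
  have hderiv : ∀ x : ℝ, HasDerivAt (fun r : ℝ => -Real.exp (-b * r ^ 2) / b)
      (2 * x * Real.exp (-b * x ^ 2)) x := by
    intro x
    have h := ((((hasDerivAt_id x).pow 2).const_mul (-b)).exp.neg).div_const b
    refine h.congr_deriv ?_
    simp
    field_simp
  have hlim : Filter.Tendsto (fun r : ℝ => -Real.exp (-b * r ^ 2) / b) Filter.atTop (nhds 0) := by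
    have h1 : Filter.Tendsto (fun r : ℝ => -b * r ^ 2) Filter.atTop Filter.atBot :=
      (Filter.tendsto_pow_atTop two_ne_zero).const_mul_atTop_of_neg (by linarith)
    simpa using ((Real.tendsto_exp_atBot.comp h1).neg).div_const b
  have hnn : ∀ x ∈ Set.Ioi R, 0 ≤ 2 * x * Real.exp (-b * x ^ 2) := fun x hx => by
    have : 0 < x := lt_of_le_of_lt hR hx
    positivity
  rw [← ofReal_integral_eq_lintegral_ofReal
    (integrableOn_Ioi_deriv_of_nonneg' (fun x _ => hderiv x) hnn hlim)
    ((ae_restrict_iff' measurableSet_Ioi).2 (Filter.Eventually.of_forall hnn)),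
    integral_Ioi_of_hasDerivAt_of_nonneg' (fun x _ => hderiv x) hnn hlim]
  congr 1
  ring

theorem lintegral_exp_mul_sq_norm_complexGaussian_one {s : ℝ} (hs : s < 1) :
    ∫⁻ z, ENNReal.ofReal (Real.exp (s * ‖z‖ ^ 2)) ∂(complexGaussian 1)
      = ENNReal.ofReal (1 - s)⁻¹ := by
  rw [lintegral_norm_complexGaussian_one (F := fun r => ENNReal.ofReal (Real.exp (s * r ^ 2)))
    (by fun_prop)]
  have h := lintegral_Ioi_mul_exp_neg_mul_sq (b := 1 - s) (by linarith) (le_refl 0)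
  simp only [ne_eq, OfNat.ofNat_ne_zero, not_false_eq_true, zero_pow, mul_zero, Real.exp_zero,
    one_div] at h
  rw [← h]
  refine setLIntegral_congr_fun measurableSet_Ioi fun r hr => ?_
  have hr' : 0 < r := hr
  rw [← ENNReal.ofReal_mul (by positivity), mul_assoc, ← Real.exp_add]
  ring_nf

theorem exp_neg_le_complexGaussian_one {a : ℝ} (ha : 0 ≤ a) :
    ENNReal.ofReal (Real.exp (-a)) ≤ complexGaussian 1 {z | a ≤ ‖z‖ ^ 2} := by
  have hm : MeasurableSet {z : ℂ | a ≤ ‖z‖ ^ 2} := measurableSet_le (by fun_prop) (by fun_prop)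
  have hm' : MeasurableSet {r : ℝ | a ≤ r ^ 2} := measurableSet_le (by fun_prop) (by fun_prop)
  have hpolar := lintegral_norm_complexGaussian_one (F := Set.indicator {r : ℝ | a ≤ r ^ 2} 1)
    (measurable_one.indicator hm')
  have hind : ∫⁻ z, Set.indicator {r : ℝ | a ≤ r ^ 2} (1 : ℝ → ENNReal) ‖z‖ ∂(complexGaussian 1)
      = complexGaussian 1 {z | a ≤ ‖z‖ ^ 2} := (lintegral_indicator_one hm)
  rw [← hind, hpolar]
  have h := lintegral_Ioi_mul_exp_neg_mul_sq (b := 1) one_pos (Real.sqrt_nonneg a)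
  rw [Real.sq_sqrt ha, div_one, neg_one_mul] at h
  rw [← h]
  refine le_trans (le_of_eq ?_) (lintegral_mono_set (Set.Ioi_subset_Ioi (Real.sqrt_nonneg a)))
  refine setLIntegral_congr_fun measurableSet_Ioi fun r hr => ?_
  have hr' : a ≤ r ^ 2 := (Real.sqrt_le_left ((Real.sqrt_nonneg a).trans hr.le)).1 hr.le
  simp [Set.indicator_of_mem (show r ∈ {r : ℝ | a ≤ r ^ 2} from hr')]

theorem lintegral_exp_mul_sum_sq_norm_complexGaussianPi_one (ι : Type*) [Fintype ι] {s : ℝ}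
    (hs : s < 1) :
    ∫⁻ g, ENNReal.ofReal (Real.exp (s * ∑ i, ‖g i‖ ^ 2)) ∂(complexGaussianPi ι 1)
      = ENNReal.ofReal (((1 - s)⁻¹) ^ Fintype.card ι) := by
  unfold complexGaussianPi
  have hi := iIndepFun_pi (μ := fun _ : ι => complexGaussian 1)
    (X := fun _ z => ENNReal.ofReal (Real.exp (s * ‖z‖ ^ 2))) (fun _ => by fun_prop)
  have h := lintegral_prod_eq_prod_lintegral_of_indepFun Finset.univ _ hi (fun i => by fun_prop)
  have h2 : ∀ g : ι → ℂ, ENNReal.ofReal (Real.exp (s * ∑ i, ‖g i‖ ^ 2))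
      = ∏ i, ENNReal.ofReal (Real.exp (s * ‖g i‖ ^ 2)) := by
    intro g
    rw [← ENNReal.ofReal_prod_of_nonneg (fun _ _ => (Real.exp_pos _).le), ← Real.exp_sum,
      Finset.mul_sum]
  simp_rw [h2]
  rw [h]
  have h3 : ∀ i : ι, ∫⁻ g : ι → ℂ, ENNReal.ofReal (Real.exp (s * ‖g i‖ ^ 2))
      ∂(Measure.pi fun _ : ι => complexGaussian 1) = ENNReal.ofReal (1 - s)⁻¹ := by
    intro i
    rw [← lintegral_exp_mul_sq_norm_complexGaussian_one hs]
    exact (measurePreserving_eval (fun _ : ι => complexGaussian 1) i).lintegral_comp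
      (f := fun z => ENNReal.ofReal (Real.exp (s * ‖z‖ ^ 2))) (by fun_prop)
  simp_rw [h3]
  rw [Finset.prod_const, Finset.card_univ, ENNReal.ofReal_pow (inv_nonneg.2 (by linarith))]

theorem complexGaussianPi_eq_map_smul (ι : Type*) [Fintype ι] (c : ℝ) :
    complexGaussianPi ι c = (complexGaussianPi ι 1).map (fun g => (c : ℂ) • g) := by
  classical
  have h := map_mulVec_complexGaussianPi ((c : ℂ) • (1 : Matrix ι ι ℂ)) c 1 (by
    ext i j
    simp [sq, mul_assoc])
  simpa [Matrix.smul_mulVec] using h.symm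

theorem lintegral_exp_mul_sum_sq_norm_complexGaussianPi (ι : Type*) [Fintype ι] {s c : ℝ}
    (hs : s * c ^ 2 < 1) :
    ∫⁻ g, ENNReal.ofReal (Real.exp (s * ∑ i, ‖g i‖ ^ 2)) ∂(complexGaussianPi ι c)
      = ENNReal.ofReal (((1 - s * c ^ 2)⁻¹) ^ Fintype.card ι) := by
  rw [complexGaussianPi_eq_map_smul, lintegral_map (by fun_prop) (by fun_prop),
    ← lintegral_exp_mul_sum_sq_norm_complexGaussianPi_one ι hs]
  refine lintegral_congr fun g => ?_
  congr 2
  simp [mul_pow, Finset.mul_sum, mul_assoc]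

/-! ### Averaging over random directions. -/

/-- A complex Gaussian vector lies in a fixed cone with aperture given by
`3 ∑_{i ≠ j} |y_i|² ≤ |y_j|²` with probability at least `4⁻ⁿ`. -/
theorem complexGaussianPi_cone {n : ℕ} (j : Fin n) :
    ENNReal.ofReal ((1 / 4) ^ n) ≤ complexGaussianPi (Fin n) 1
      {y | 3 * ∑ i ∈ Finset.univ.erase j, ‖y i‖ ^ 2 ≤ ‖y j‖ ^ 2} := by
  obtain _ | m := n
  · exact j.elim0
  have hmp := measurePreserving_piFinSuccAbove (fun _ : Fin (m + 1) => complexGaussian 1) j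
  let C : Set (ℂ × (Fin m → ℂ)) := {p | 3 * ∑ i, ‖p.2 i‖ ^ 2 ≤ ‖p.1‖ ^ 2}
  have hC : MeasurableSet C := measurableSet_le (by fun_prop) (by fun_prop)
  have hpre : {y : Fin (m + 1) → ℂ | 3 * ∑ i ∈ Finset.univ.erase j, ‖y i‖ ^ 2 ≤ ‖y j‖ ^ 2}
      = MeasurableEquiv.piFinSuccAbove (fun _ => ℂ) j ⁻¹' C := by
    ext y
    have : ∑ i ∈ Finset.univ.erase j, ‖y i‖ ^ 2 = ∑ i : Fin m, ‖y (j.succAbove i)‖ ^ 2 := by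
      have h1 := Fin.sum_univ_succAbove (fun i => ‖y i‖ ^ 2) j
      have h2 := Finset.add_sum_erase Finset.univ (fun i => ‖y i‖ ^ 2) (Finset.mem_univ j)
      linarith
    rw [Set.mem_ofPred_eq, this]
    simp [C, MeasurableEquiv.piFinSuccAbove, Fin.insertNthEquiv, Fin.removeNth]
  rw [hpre]
  unfold complexGaussianPi
  rw [hmp.measure_preimage hC.nullMeasurableSet, Measure.prod_apply_symm hC]
  -- Given the other coordinates `y`, the exponential tail of `|y_j|²` bounds the conditional
  -- probability below by `exp (-3 ‖y‖²)`. Its mean is `(1 + 3)⁻¹` to the power `m = n - 1`, which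
  -- exceeds `4⁻ⁿ`.
  have hsec : ∀ y : Fin m → ℂ, ENNReal.ofReal (Real.exp (-3 * ∑ i, ‖y i‖ ^ 2))
      ≤ complexGaussian 1 ((fun x => (x, y)) ⁻¹' C) := by
    intro y
    have := exp_neg_le_complexGaussian_one (a := 3 * ∑ i, ‖y i‖ ^ 2) (by positivity)
    rw [neg_mul]
    exact this
  refine le_trans ?_ (lintegral_mono hsec)
  have := lintegral_exp_mul_sum_sq_norm_complexGaussianPi_one (Fin m) (s := -3) (by norm_num)
  unfold complexGaussianPi at this
  rw [this]
  apply ENNReal.ofReal_le_ofReal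
  rw [Fintype.card_fin, pow_succ]
  norm_num

theorem star_dotProduct_mulVec_of_spectral {ι κ : Type*} [Fintype ι] [Fintype κ] [DecidableEq κ]
    {M : Matrix ι ι ℂ} {V : Matrix ι κ ℂ} {l : κ → ℝ}
    (hM : M = V * Matrix.diagonal (fun j => (l j : ℂ)) * Vᴴ) (x : ι → ℂ) :
    star x ⬝ᵥ M *ᵥ x = ((∑ i, l i * ‖(Vᴴ *ᵥ x) i‖ ^ 2 : ℝ) : ℂ) := by
  rw [hM, ← Matrix.mulVec_mulVec, ← Matrix.mulVec_mulVec, Matrix.dotProduct_mulVec]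
  have : star x ᵥ* V = star (Vᴴ *ᵥ x) := by
    rw [Matrix.star_mulVec, Matrix.conjTranspose_conjTranspose]
  rw [this]
  simp only [dotProduct, Matrix.mulVec_diagonal, Pi.star_apply, RCLike.star_def,
    Complex.ofReal_sum, Complex.ofReal_mul, Complex.ofReal_pow]
  refine Finset.sum_congr rfl fun i _ => ?_
  rw [← Complex.conj_mul']
  ring

theorem sum_sq_norm_conjTranspose_mulVec {ι κ : Type*} [Fintype ι] [Fintype κ] [DecidableEq ι]
    {V : Matrix ι κ ℂ} (hV : V * Vᴴ = 1) (x : ι → ℂ) :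
    ∑ i, ‖(Vᴴ *ᵥ x) i‖ ^ 2 = ∑ i, ‖x i‖ ^ 2 := by
  have : ((∑ i, ‖(Vᴴ *ᵥ x) i‖ ^ 2 : ℝ) : ℂ) = ((∑ i, ‖x i‖ ^ 2 : ℝ) : ℂ) := by
    rw [← star_dotProduct_self, Matrix.star_mulVec, Matrix.conjTranspose_conjTranspose,
      Matrix.dotProduct_mulVec, Matrix.vecMul_vecMul, hV, Matrix.vecMul_one, star_dotProduct_self]
  exact_mod_cast this

theorem isHermitian_eq_mul_diagonal_mul {n : ℕ} {M : Matrix (Fin n) (Fin n) ℂ}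
    (hM : M.IsHermitian) :
    M = (hM.eigenvectorUnitary : Matrix (Fin n) (Fin n) ℂ)
      * Matrix.diagonal (fun j => (hM.eigenvalues j : ℂ))
      * (hM.eigenvectorUnitary : Matrix (Fin n) (Fin n) ℂ)ᴴ := by
  have := hM.spectral_theorem
  rw [Unitary.conjStarAlgAut_apply] at this
  exact this

/-- The worst case is `l (q - R)`, and `3 R ≤ q` is exactly `(q + R) / 2 ≤ q - R`. This fixes the
constant 3 of the cone and the loss of a factor 2 in the eigenvalue. -/
theorem cone_inequality {q R l a T : ℝ} (hR : 0 ≤ R) (hq : 3 * R ≤ q) (hl : 0 ≤ l)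
    (ha : 2 * a ≤ l) (hT : -(l * R) ≤ T) : a * (q + R) ≤ l * q + T := by
  have h1 : a * (q + R) ≤ l / 2 * (q + R) :=
    mul_le_mul_of_nonneg_right (by linarith) (by linarith)
  nlinarith

/-- The Hermitian matrix `M` has an eigenvalue that is at least `b` and that dominates all the
eigenvalues of `M` in absolute value. -/
def HasDominantEigenvalueGE {n : ℕ} (M : Matrix (Fin n) (Fin n) ℂ) (b : ℝ) : Prop :=
  ∃ V ∈ Matrix.unitaryGroup (Fin n) ℂ, ∃ l : Fin n → ℝ,
    M = V * Matrix.diagonal (fun j => (l j : ℂ)) * Vᴴ ∧ ∃ j, b ≤ l j ∧ ∀ i, |l i| ≤ l j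

theorem HasDominantEigenvalueGE.complexGaussianPi_quadratic_form_ge {n : ℕ}
    {M : Matrix (Fin n) (Fin n) ℂ} {a : ℝ} (hM : HasDominantEigenvalueGE M (2 * a)) :
    ENNReal.ofReal ((1 / 4) ^ n) ≤ complexGaussianPi (Fin n) 1
      {x | a * ∑ i, ‖x i‖ ^ 2 ≤ (star x ⬝ᵥ M *ᵥ x).re} := by
  obtain ⟨V, hV, l, hMV, j, hj, hmax⟩ := hM
  have hV1 : Vᴴ * V = 1 := (Unitary.mem_iff.1 hV).1
  have hV2 : V * Vᴴ = 1 := (Unitary.mem_iff.1 hV).2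
  have hmap := map_mulVec_complexGaussianPi Vᴴ 1 1 (by simp [hV1])
  have hcont : Continuous fun g : Fin n → ℂ => Vᴴ *ᵥ g :=
    Continuous.matrix_mulVec continuous_const continuous_id
  rw [mul_one] at hmap
  refine (complexGaussianPi_cone j).trans ?_
  rw [← hmap, Measure.map_apply hcont.measurable
    (measurableSet_le (by fun_prop) (by fun_prop)), hmap]
  refine measure_mono fun x hx => ?_
  simp only [Set.mem_preimage, Set.mem_ofPred_eq] at hx
  rw [Set.mem_ofPred_eq, star_dotProduct_mulVec_of_spectral hMV,
    Complex.ofReal_re, ← sum_sq_norm_conjTranspose_mulVec hV2,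
    ← Finset.add_sum_erase Finset.univ _ (Finset.mem_univ j),
    ← Finset.add_sum_erase Finset.univ (fun i => _ * _) (Finset.mem_univ j)]
  have hl : 0 ≤ l j := (abs_nonneg _).trans (hmax j)
  have hsum : -(l j * ∑ i ∈ Finset.univ.erase j, ‖(Vᴴ *ᵥ x) i‖ ^ 2)
      ≤ ∑ i ∈ Finset.univ.erase j, l i * ‖(Vᴴ *ᵥ x) i‖ ^ 2 := by
    rw [Finset.mul_sum, ← Finset.sum_neg_distrib]
    refine Finset.sum_le_sum fun i _ => ?_
    rw [← neg_mul]
    exact mul_le_mul_of_nonneg_right (abs_le.1 (hmax i)).1 (by positivity)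
  exact cone_inequality (Finset.sum_nonneg fun _ _ => by positivity) hx hl hj hsum

theorem complexGaussian_one_singleton_zero : complexGaussian 1 {0} = 0 := by
  rw [← lintegral_indicator_one (measurableSet_singleton 0),
    lintegral_complexGaussian_one (measurable_one.indicator (measurableSet_singleton 0))]
  refine lintegral_eq_zero_of_ae_eq_zero ?_
  filter_upwards [Measure.ae_ne volume (0 : ℂ)] with z hz
  simp [hz]

theorem ae_sum_sq_norm_pos {ι : Type*} [Fintype ι] (j : ι) :
    ∀ᵐ x ∂(complexGaussianPi ι 1), 0 < ∑ i, ‖x i‖ ^ 2 := by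
  have h : ∀ᵐ x ∂(complexGaussianPi ι 1), x j ≠ 0 := by
    refine (measurePreserving_eval (fun _ : ι => complexGaussian 1) j).quasiMeasurePreserving.ae
      (p := fun z : ℂ => z ≠ 0) ?_
    rw [ae_iff]
    simpa using complexGaussian_one_singleton_zero
  filter_upwards [h] with x hx
  exact Finset.sum_pos' (fun _ _ => by positivity)
    ⟨j, Finset.mem_univ j, by have := norm_pos_iff.2 hx; positivity⟩

/-- If the exponential moments of `xᴴ H x` are uniformly bounded over unit vectors `x`, then the
top eigenvalue of the random Hermitian matrix `H` is unlikely to be large when it dominates the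
spectrum. This averages over the direction `x`. -/
theorem measure_hasDominantEigenvalueGE_le {Ω : Type*} [MeasurableSpace Ω] (μ : Measure Ω)
    [IsProbabilityMeasure μ] {n : ℕ} (H : Ω → Matrix (Fin n) (Fin n) ℂ)
    (hmeas : ∀ i j, Measurable fun ω => H ω i j)
    {s a C : ℝ} (hs : 0 ≤ s) (hC : 1 ≤ C)
    (hmgf : ∀ x : Fin n → ℂ, ∑ i, ‖x i‖ ^ 2 = 1 →
      ∫⁻ ω, ENNReal.ofReal (Real.exp (s * (star x ⬝ᵥ H ω *ᵥ x).re)) ∂μ ≤ ENNReal.ofReal C) :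
    μ {ω | HasDominantEigenvalueGE (H ω) (2 * a)}
      ≤ ENNReal.ofReal (4 ^ n * C * Real.exp (-(s * a))) := by
  let r : (Fin n → ℂ) → ℝ := fun x => ∑ i, ‖x i‖ ^ 2
  let F : Ω → (Fin n → ℂ) → ENNReal := fun ω x =>
    ENNReal.ofReal (Real.exp (s * ((star x ⬝ᵥ H ω *ᵥ x).re / r x)))
  have hF : Measurable (Function.uncurry F) := by
    have hq : Measurable fun p : Ω × (Fin n → ℂ) => (star p.2 ⬝ᵥ H p.1 *ᵥ p.2) := by
      simp only [dotProduct, Matrix.mulVec, Pi.star_apply, RCLike.star_def]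
      refine Finset.measurable_sum _ fun i _ => Measurable.mul ?_ ?_
      · exact Complex.continuous_conj.measurable.comp (by fun_prop)
      · refine Finset.measurable_sum _ fun j _ => Measurable.mul ?_ (by fun_prop)
        exact (hmeas i j).comp measurable_fst
    have hr : Measurable fun p : Ω × (Fin n → ℂ) => r p.2 := by
      simp only [r]; fun_prop
    have := ((Complex.measurable_re.comp hq).div hr).const_mul s
    exact ENNReal.measurable_ofReal.comp (Real.measurable_exp.comp this)
  have hupper : ∫⁻ ω, ∫⁻ x, F ω x ∂(complexGaussianPi (Fin n) 1) ∂μ ≤ ENNReal.ofReal C := by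
    rw [lintegral_lintegral_swap hF.aemeasurable]
    have : ∀ x, ∫⁻ ω, F ω x ∂μ ≤ ENNReal.ofReal C := by
      intro x
      -- At `x = 0` the quotient in `F` has the default value 0, so `F = 1`; this case uses `1 ≤ C`.
      -- Otherwise `x` is rescaled to a unit vector.
      by_cases hx : r x = 0
      · simp only [F, hx, div_zero, mul_zero, Real.exp_zero, ENNReal.ofReal_one, lintegral_const,
          measure_univ, mul_one]
        simpa using hC
      · have hr0 : 0 < r x := lt_of_le_of_ne (by positivity) (Ne.symm hx)
        refine le_trans (le_of_eq ?_) (hmgf (((√(r x))⁻¹ : ℂ) • x) ?_)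
        · refine lintegral_congr fun ω => ?_
          simp only [F]
          congr 3
          rw [Matrix.mulVec_smul, star_smul, smul_dotProduct, dotProduct_smul, smul_smul]
          have : star ((√(r x) : ℂ))⁻¹ * ((√(r x) : ℂ))⁻¹ = (((r x)⁻¹ : ℝ) : ℂ) := by
            rw [RCLike.star_def, map_inv₀, Complex.conj_ofReal, ← mul_inv, ← Complex.ofReal_mul,
              Real.mul_self_sqrt hr0.le, Complex.ofReal_inv]
          rw [this, smul_eq_mul, Complex.re_ofReal_mul]
          ring
        · simp only [Pi.smul_apply, smul_eq_mul, norm_mul, norm_inv, Complex.norm_real, mul_pow,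
            Real.norm_eq_abs, inv_pow, sq_abs, Real.sq_sqrt hr0.le, ← Finset.mul_sum]
          exact inv_mul_cancel₀ hx
    calc _ ≤ ∫⁻ _, ENNReal.ofReal C ∂(complexGaussianPi (Fin n) 1) := lintegral_mono this
      _ = _ := by simp
  set c := ENNReal.ofReal (Real.exp (s * a) * (1 / 4) ^ n) with hc
  -- On the event, the cone alone contributes `exp (s a) 4⁻ⁿ` to the average of `F ω`. Markov's
  -- inequality is then applied to that average.
  have hsub : {ω | HasDominantEigenvalueGE (H ω) (2 * a)}
      ⊆ {ω | c ≤ ∫⁻ x, F ω x ∂(complexGaussianPi (Fin n) 1)} := by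
    intro ω hω
    have h1 := hω.complexGaussianPi_quadratic_form_ge
    -- The index `j` witnesses `n > 0`, which makes the Gaussian vector almost surely nonzero.
    obtain ⟨-, -, -, -, j, -⟩ := hω
    rw [Set.mem_ofPred_eq, hc, ENNReal.ofReal_mul (Real.exp_pos _).le]
    refine (mul_le_mul_right h1 _).trans ?_
    rw [← setLIntegral_const]
    refine le_trans (lintegral_mono_ae ?_) (setLIntegral_le_lintegral _ _)
    have hmS : MeasurableSet {x : Fin n → ℂ | a * ∑ i, ‖x i‖ ^ 2 ≤ (star x ⬝ᵥ H ω *ᵥ x).re} := by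
      refine measurableSet_le (by fun_prop) (Continuous.measurable ?_)
      exact Complex.continuous_re.comp (Continuous.dotProduct continuous_star
        (Continuous.matrix_mulVec continuous_const continuous_id))
    filter_upwards [ae_restrict_mem hmS, ae_restrict_of_ae (ae_sum_sq_norm_pos j)] with x hx hpos
    refine ENNReal.ofReal_le_ofReal (Real.exp_le_exp.2 (mul_le_mul_of_nonneg_left ?_ hs))
    exact (le_div_iff₀ hpos).2 hx
  refine (measure_mono hsub).trans ?_
  refine (meas_ge_le_lintegral_div hF.lintegral_prod_right.aemeasurable ?_ ENNReal.ofReal_ne_top).trans ?_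
  · simp only [ne_eq, ENNReal.ofReal_eq_zero, not_le]; positivity
  refine (ENNReal.div_le_div_right hupper _).trans ?_
  rw [← ENNReal.ofReal_div_of_pos (by positivity)]
  apply ENNReal.ofReal_le_ofReal
  rw [Real.exp_neg, one_div, inv_pow]
  apply le_of_eq
  field_simp

/-! ### Operator norms from dominant eigenvalues. -/

theorem l2_opNorm_le_of_spectral {n : ℕ} {M V : Matrix (Fin n) (Fin n) ℂ} {l : Fin n → ℝ}
    (hV : V ∈ Matrix.unitaryGroup (Fin n) ℂ)
    (hM : M = V * Matrix.diagonal (fun j => (l j : ℂ)) * Vᴴ) {b : ℝ} (hb : 0 ≤ b)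
    (hl : ∀ i, |l i| ≤ b) : ‖M‖ ≤ b := by
  rw [hM, ← Matrix.star_eq_conjTranspose, CStarRing.norm_mul_mem_unitary _ (Unitary.star_mem hV),
    CStarRing.norm_mem_unitary_mul _ hV,
    Matrix.l2_opNorm_diagonal, pi_norm_le_iff_of_nonneg hb]
  intro i
  simpa using hl i

theorem exists_spectral_of_isHermitian {n : ℕ} {M : Matrix (Fin n) (Fin n) ℂ}
    (hM : M.IsHermitian) : ∃ V ∈ Matrix.unitaryGroup (Fin n) ℂ,
      M = V * Matrix.diagonal (fun j => (hM.eigenvalues j : ℂ)) * Vᴴ :=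
  ⟨_, hM.eigenvectorUnitary.2, isHermitian_eq_mul_diagonal_mul hM⟩

/-- An eigenvalue of largest modulus is, up to sign, a dominant eigenvalue of `M` or of `-M`. For
positive semidefinite matrices one sign suffices. -/
theorem l2_opNorm_le_of_not_hasDominantEigenvalueGE {n : ℕ} {M : Matrix (Fin n) (Fin n) ℂ}
    (hM : M.IsHermitian) {b : ℝ} (hb : 0 ≤ b) (h1 : ¬ HasDominantEigenvalueGE M b)
    (h2 : ¬ HasDominantEigenvalueGE (-M) b) : ‖M‖ ≤ b := by
  obtain ⟨V, hV, hMV⟩ := exists_spectral_of_isHermitian hM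
  refine l2_opNorm_le_of_spectral hV hMV hb ?_
  by_contra! hcon
  obtain ⟨i₀, hi₀⟩ := hcon
  obtain ⟨j, -, hj⟩ := Finset.exists_max_image Finset.univ (fun i => |hM.eigenvalues i|)
    ⟨i₀, Finset.mem_univ _⟩
  have hbj : b ≤ |hM.eigenvalues j| := hi₀.le.trans (hj i₀ (Finset.mem_univ _))
  rcases le_total 0 (hM.eigenvalues j) with h | h
  · rw [abs_of_nonneg h] at hbj hj
    exact h1 ⟨V, hV, _, hMV, j, hbj, fun i => hj i (Finset.mem_univ _)⟩
  · rw [abs_of_nonpos h] at hbj hj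
    refine h2 ⟨V, hV, fun i => -hM.eigenvalues i, ?_, j, hbj, fun i => ?_⟩
    · have : (Matrix.diagonal fun i => ((-hM.eigenvalues i : ℝ) : ℂ))
          = -Matrix.diagonal fun i => (hM.eigenvalues i : ℂ) := by
        rw [Matrix.diagonal_neg]
        congr 1
        ext i
        simp
      rw [this, mul_neg, neg_mul, ← hMV]
    · rw [abs_neg]
      exact hj i (Finset.mem_univ _)

theorem l2_opNorm_le_of_posSemidef_of_not_hasDominantEigenvalueGE {n : ℕ}
    {M : Matrix (Fin n) (Fin n) ℂ} (hM : M.PosSemidef) {b : ℝ} (hb : 0 ≤ b)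
    (h : ¬ HasDominantEigenvalueGE M b) : ‖M‖ ≤ b := by
  obtain ⟨V, hV, hMV⟩ := exists_spectral_of_isHermitian hM.isHermitian
  refine l2_opNorm_le_of_spectral hV hMV hb ?_
  by_contra! hcon
  obtain ⟨i₀, hi₀⟩ := hcon
  obtain ⟨j, -, hj⟩ := Finset.exists_max_image Finset.univ hM.isHermitian.eigenvalues
    ⟨i₀, Finset.mem_univ _⟩
  simp only [abs_of_nonneg (hM.eigenvalues_nonneg _)] at hi₀
  refine h ⟨V, hV, _, hMV, j, hi₀.le.trans (hj i₀ (Finset.mem_univ _)), fun i => ?_⟩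
  rw [abs_of_nonneg (hM.eigenvalues_nonneg i)]
  exact hj i (Finset.mem_univ _)

theorem conjTranspose_mulVec_dotProduct {m n : Type*} [Fintype m] [Fintype n]
    (X : Matrix m n ℂ) (x : m → ℂ) :
    star x ⬝ᵥ (X * Xᴴ) *ᵥ x = ((∑ l, ‖(Xᴴ *ᵥ x) l‖ ^ 2 : ℝ) : ℂ) := by
  rw [← Matrix.mulVec_mulVec, Matrix.dotProduct_mulVec, ← star_dotProduct_self,
    Matrix.star_mulVec, Matrix.conjTranspose_conjTranspose]

/-! ### Exponential moments of a Gaussian matrix along a fixed vector. -/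

section ExponentialMoments

variable {N L : ℕ}

/-- As a linear map of the entries, `e ↦ e w` is `‖w‖` times a co-isometry, so its image is a
Gaussian vector in `ℂ^N` of scale `‖w‖`. -/
theorem lintegral_exp_mul_sum_sq_norm_mulVec (w : Fin L → ℂ) {s : ℝ}
    (hs : s * ∑ l, ‖w l‖ ^ 2 < 1) :
    ∫⁻ e, ENNReal.ofReal (Real.exp
        (s * ∑ n, ‖((Matrix.of fun n l => e (n, l) : Matrix (Fin N) (Fin L) ℂ) *ᵥ w) n‖ ^ 2))
        ∂(complexGaussianPi (Fin N × Fin L) 1)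
      = ENNReal.ofReal (((1 - s * ∑ l, ‖w l‖ ^ 2)⁻¹) ^ N) := by
  let M : Matrix (Fin N) (Fin N × Fin L) ℂ :=
    Matrix.of fun n p => if n = p.1 then w p.2 else 0
  set c := √(∑ l, ‖w l‖ ^ 2) with hc
  have hc2 : c ^ 2 = ∑ l, ‖w l‖ ^ 2 := Real.sq_sqrt (by positivity)
  have hM : M * Mᴴ = ((c ^ 2 : ℝ) : ℂ) • (1 : Matrix (Fin N) (Fin N) ℂ) := by
    ext i j
    rw [hc2]
    simp only [M, Matrix.mul_apply, Fintype.sum_prod_type, Matrix.of_apply,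
      Matrix.conjTranspose_apply, Matrix.smul_apply, Matrix.one_apply, smul_eq_mul]
    by_cases hij : i = j
    · subst hij
      simp [Finset.sum_ite_eq, apply_ite star, Complex.mul_conj', ← ite_and]
    · simp only [hij, if_false, mul_zero]
      refine Finset.sum_eq_zero fun k _ => Finset.sum_eq_zero fun l _ => ?_
      by_cases h1 : i = k
      · have : j ≠ k := fun h => hij (h1.trans h.symm)
        simp [this]
      · simp [h1]
  have hmap := map_mulVec_complexGaussianPi M c 1 hM
  rw [mul_one] at hmap
  have hcont : Continuous fun g : Fin N × Fin L → ℂ => M *ᵥ g :=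
    Continuous.matrix_mulVec continuous_const continuous_id
  have h := lintegral_exp_mul_sum_sq_norm_complexGaussianPi (Fin N) (s := s) (c := c) (by rwa [hc2])
  rw [hc2, Fintype.card_fin, ← hmap, lintegral_map (by fun_prop) hcont.measurable] at h
  rw [← h]
  refine lintegral_congr fun e => ?_
  congr 3
  refine Finset.sum_congr rfl fun n _ => ?_
  congr 2
  simp [M, Matrix.mulVec, dotProduct, Fintype.sum_prod_type, mul_comm]

theorem lintegral_exp_mul_sum_sq_norm_conjTranspose_mulVec (x : Fin N → ℂ) {s : ℝ}
    (hs : s * ∑ n, ‖x n‖ ^ 2 < 1) :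
    ∫⁻ e, ENNReal.ofReal (Real.exp
        (s * ∑ l, ‖((Matrix.of fun n l => e (n, l) : Matrix (Fin N) (Fin L) ℂ)ᴴ *ᵥ x) l‖ ^ 2))
        ∂(complexGaussianPi (Fin N × Fin L) 1)
      = ENNReal.ofReal (((1 - s * ∑ n, ‖x n‖ ^ 2)⁻¹) ^ L) := by
  let M : Matrix (Fin L) (Fin N × Fin L) ℂ :=
    Matrix.of fun l p => if l = p.2 then star (x p.1) else 0
  set c := √(∑ n, ‖x n‖ ^ 2) with hc
  have hc2 : c ^ 2 = ∑ n, ‖x n‖ ^ 2 := Real.sq_sqrt (by positivity)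
  have hM : M * Mᴴ = ((c ^ 2 : ℝ) : ℂ) • (1 : Matrix (Fin L) (Fin L) ℂ) := by
    ext i j
    rw [hc2]
    simp only [M, Matrix.mul_apply, Fintype.sum_prod_type, Matrix.of_apply,
      Matrix.conjTranspose_apply, Matrix.smul_apply, Matrix.one_apply, smul_eq_mul]
    by_cases hij : i = j
    · subst hij
      simp [apply_ite star, Complex.conj_mul', ← ite_and]
    · simp only [hij, if_false, mul_zero]
      refine Finset.sum_eq_zero fun k _ => Finset.sum_eq_zero fun l _ => ?_
      by_cases h1 : i = l
      · have : j ≠ l := fun h => hij (h1.trans h.symm)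
        simp [this]
      · simp [h1]
  have hmap := map_mulVec_complexGaussianPi M c 1 hM
  rw [mul_one] at hmap
  have hcont : Continuous fun g : Fin N × Fin L → ℂ => M *ᵥ g :=
    Continuous.matrix_mulVec continuous_const continuous_id
  have h := lintegral_exp_mul_sum_sq_norm_complexGaussianPi (Fin L) (s := s) (c := c) (by rwa [hc2])
  rw [hc2, Fintype.card_fin, ← hmap, lintegral_map (by fun_prop) hcont.measurable] at h
  rw [← h]
  refine lintegral_congr fun e => ?_
  congr 3
  refine Finset.sum_congr rfl fun l _ => ?_
  congr 1
  rw [← norm_star]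
  congr 1
  simp [M, Matrix.mulVec, dotProduct, Fintype.sum_prod_type, mul_comm]

end ExponentialMoments

/-! ### Scalar inequalities. -/

/-- Apply `log u ≤ sinh (log u) = (u - u⁻¹) / 2` to `u = (1 - s)⁻¹`. -/
theorem exp_neg_mul_inv_one_sub_le {s : ℝ} (h0 : 0 ≤ s) (h1 : s < 1) :
    Real.exp (-s) * (1 - s)⁻¹ ≤ Real.exp (s ^ 2 / (2 * (1 - s))) := by
  have hs : 0 < 1 - s := by linarith
  have hu : (1 : ℝ) ≤ (1 - s)⁻¹ := (one_le_inv₀ hs).2 (by linarith)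
  have h := Real.self_le_sinh_iff.2 (Real.log_nonneg hu)
  rw [Real.sinh_log (by positivity), inv_inv] at h
  nth_rewrite 1 [← Real.exp_log (show (0 : ℝ) < (1 - s)⁻¹ by positivity)]
  rw [← Real.exp_add, Real.exp_le_exp]
  have : ((1 - s)⁻¹ - (1 - s)) / 2 - s = s ^ 2 / (2 * (1 - s)) := by
    field_simp
    ring
  linarith

theorem exp_mul_inv_one_add_le {s : ℝ} (h0 : 0 ≤ s) (h1 : s < 1) :
    Real.exp s * (1 + s)⁻¹ ≤ Real.exp (s ^ 2 / (2 * (1 - s))) := by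
  have h := Real.le_log_one_add_of_nonneg h0
  rw [← Real.exp_log (show (0 : ℝ) < 1 + s by positivity), ← Real.exp_neg, ← Real.exp_add,
    Real.exp_le_exp]
  have h2 : s ^ 2 / (s + 2) ≤ s ^ 2 / (2 * (1 - s)) :=
    div_le_div_of_nonneg_left (by positivity) (by linarith) (by linarith)
  have h3 : s - 2 * s / (s + 2) = s ^ 2 / (s + 2) := by
    field_simp
    ring
  linarith

/-- The exponents balance because `2 log 2 + 0.61 - 2.6 < -1/2`. -/
theorem four_pow_mul_exp_mul_exp_le (N : ℕ) {u v : ℝ} (hu : u ≤ 0.61 * N) (hv : 2.6 * N ≤ v) :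
    4 ^ N * Real.exp u * Real.exp (-v) ≤ Real.exp (-(N : ℝ) / 2) := by
  have h4 : (4 : ℝ) = Real.exp (2 * Real.log 2) := by
    rw [mul_comm, Real.exp_mul, Real.exp_log two_pos]; norm_num
  rw [h4, ← Real.exp_nat_mul, ← Real.exp_add, ← Real.exp_add, Real.exp_le_exp]
  have := Real.log_two_lt_d9
  have hN : (0 : ℝ) ≤ N := N.cast_nonneg
  nlinarith

/-- Here `log (4 / 0.3) ≤ 2.65 = 3.15 - 1/2`. -/
theorem four_pow_mul_pow_mul_exp_le {K N : ℕ} (hKN : K ≤ N) :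
    (4 : ℝ) ^ K * (1 - 0.7)⁻¹ ^ N * Real.exp (-(3.15 * N)) ≤ Real.exp (-(N : ℝ) / 2) := by
  have h1 : (4 : ℝ) ^ K ≤ 4 ^ N := pow_le_pow_right₀ (by norm_num) hKN
  have h2 : (4 : ℝ) * (1 - 0.7)⁻¹ ≤ Real.exp 2.65 := by
    have e1 := Real.exp_one_gt_d9
    have e2 := Real.quadratic_le_exp_of_nonneg (show (0 : ℝ) ≤ 0.65 by norm_num)
    have : Real.exp 2.65 = Real.exp 1 * Real.exp 1 * Real.exp 0.65 := by
      rw [← Real.exp_add, ← Real.exp_add]; norm_num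
    rw [this]
    have e3 : (7.38 : ℝ) ≤ Real.exp 1 * Real.exp 1 := by nlinarith
    norm_num at e2 ⊢
    nlinarith
  calc (4 : ℝ) ^ K * (1 - 0.7)⁻¹ ^ N * Real.exp (-(3.15 * N))
      ≤ 4 ^ N * (1 - 0.7)⁻¹ ^ N * Real.exp (-(3.15 * N)) := by gcongr
    _ = (4 * (1 - 0.7)⁻¹) ^ N * Real.exp (-(3.15 * N)) := by rw [mul_pow]
    _ ≤ Real.exp 2.65 ^ N * Real.exp (-(3.15 * N)) := by gcongr
    _ = Real.exp (-(N : ℝ) / 2) := by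
      rw [← Real.exp_nat_mul, ← Real.exp_add]
      congr 1
      ring

theorem min_one_mul_max_sq {r : ℝ} (hr : 0 ≤ r) : min r 1 * max r (r ^ 2) = r ^ 2 := by
  rcases le_total r 1 with h | h
  · rw [min_eq_left h, max_eq_left (by nlinarith)]; ring
  · rw [min_eq_right h, max_eq_right (by nlinarith)]; ring

/-! ### Tail bounds for the noise matrices. -/

section Wishart

variable {N L : ℕ}

/-- The matrix with entries given by a family indexed by pairs. -/
def ofPairs (e : Fin N × Fin L → ℂ) : Matrix (Fin N) (Fin L) ℂ :=
  Matrix.of fun n l => e (n, l)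

theorem continuous_ofPairs : Continuous (ofPairs : (Fin N × Fin L → ℂ) → Matrix _ _ ℂ) :=
  continuous_matrix fun n l => continuous_apply (n, l)

theorem star_dotProduct_wishart_mulVec (X : Matrix (Fin N) (Fin L) ℂ) {x : Fin N → ℂ}
    (hx : ∑ i, ‖x i‖ ^ 2 = 1) :
    (star x ⬝ᵥ (X * Xᴴ - (L : ℂ) • 1) *ᵥ x).re = (∑ l, ‖(Xᴴ *ᵥ x) l‖ ^ 2) - L := by
  rw [Matrix.sub_mulVec, dotProduct_sub, conjTranspose_mulVec_dotProduct, Matrix.smul_mulVec,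
    Matrix.one_mulVec, dotProduct_smul, star_dotProduct_self, hx, Complex.sub_re,
    Complex.ofReal_re]
  simp

theorem wishart_mgf_le {x : Fin N → ℂ} (hx : ∑ i, ‖x i‖ ^ 2 = 1) {s : ℝ} (h0 : 0 ≤ s)
    (h1 : s < 1) :
    ∫⁻ e, ENNReal.ofReal (Real.exp
        (s * (star x ⬝ᵥ (ofPairs e * (ofPairs e)ᴴ - (L : ℂ) • 1) *ᵥ x).re))
        ∂(complexGaussianPi (Fin N × Fin L) 1)
      ≤ ENNReal.ofReal (Real.exp (L * (s ^ 2 / (2 * (1 - s))))) := by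
  have h := lintegral_exp_mul_sum_sq_norm_conjTranspose_mulVec (N := N) (L := L) x (s := s)
    (by rw [hx]; linarith)
  rw [hx, mul_one] at h
  have hs : 0 < 1 - s := by linarith
  have he : ∀ e : Fin N × Fin L → ℂ, ENNReal.ofReal (Real.exp
        (s * (star x ⬝ᵥ (ofPairs e * (ofPairs e)ᴴ - (L : ℂ) • 1) *ᵥ x).re))
      = ENNReal.ofReal (Real.exp (-s) ^ L)
        * ENNReal.ofReal (Real.exp (s * ∑ l, ‖((ofPairs e)ᴴ *ᵥ x) l‖ ^ 2)) := by
    intro e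
    rw [star_dotProduct_wishart_mulVec _ hx, ← ENNReal.ofReal_mul (by positivity),
      ← Real.exp_nat_mul, ← Real.exp_add]
    ring_nf
  simp_rw [he]
  rw [lintegral_const_mul' _ _ ENNReal.ofReal_ne_top]
  unfold ofPairs
  rw [h, ← ENNReal.ofReal_mul (by positivity), ← mul_pow, Real.exp_nat_mul]
  exact ENNReal.ofReal_le_ofReal
    (pow_le_pow_left₀ (by positivity) (exp_neg_mul_inv_one_sub_le h0 h1) _)

theorem neg_wishart_mgf_le {x : Fin N → ℂ} (hx : ∑ i, ‖x i‖ ^ 2 = 1) {s : ℝ} (h0 : 0 ≤ s)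
    (h1 : s < 1) :
    ∫⁻ e, ENNReal.ofReal (Real.exp
        (s * (star x ⬝ᵥ (-(ofPairs e * (ofPairs e)ᴴ - (L : ℂ) • 1)) *ᵥ x).re))
        ∂(complexGaussianPi (Fin N × Fin L) 1)
      ≤ ENNReal.ofReal (Real.exp (L * (s ^ 2 / (2 * (1 - s))))) := by
  have h := lintegral_exp_mul_sum_sq_norm_conjTranspose_mulVec (N := N) (L := L) x (s := -s)
    (by rw [hx]; linarith)
  rw [hx, mul_one, sub_neg_eq_add] at h
  have he : ∀ e : Fin N × Fin L → ℂ, ENNReal.ofReal (Real.exp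
        (s * (star x ⬝ᵥ (-(ofPairs e * (ofPairs e)ᴴ - (L : ℂ) • 1)) *ᵥ x).re))
      = ENNReal.ofReal (Real.exp s ^ L)
        * ENNReal.ofReal (Real.exp (-s * ∑ l, ‖((ofPairs e)ᴴ *ᵥ x) l‖ ^ 2)) := by
    intro e
    rw [Matrix.neg_mulVec, dotProduct_neg, Complex.neg_re, star_dotProduct_wishart_mulVec _ hx,
      ← ENNReal.ofReal_mul (by positivity), ← Real.exp_nat_mul, ← Real.exp_add]
    ring_nf
  simp_rw [he]
  rw [lintegral_const_mul' _ _ ENNReal.ofReal_ne_top]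
  unfold ofPairs
  rw [h, ← ENNReal.ofReal_mul (by positivity), ← mul_pow, Real.exp_nat_mul]
  exact ENNReal.ofReal_le_ofReal
    (pow_le_pow_left₀ (by positivity) (exp_mul_inv_one_add_le h0 h1) _)

theorem measurable_matrix_entry {ι κ : Type*} {Ω : Type*} [TopologicalSpace Ω] [MeasurableSpace Ω]
    [BorelSpace Ω] {H : Ω → Matrix ι κ ℂ} (hH : Continuous H) (i : ι) (j : κ) :
    Measurable fun ω => H ω i j :=
  (hH.matrix_elem i j).measurable

theorem continuous_wishart : Continuous fun e : Fin N × Fin L → ℂ =>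
    ofPairs e * (ofPairs e)ᴴ - (L : ℂ) • (1 : Matrix (Fin N) (Fin N) ℂ) :=
  ((continuous_ofPairs.matrix_mul continuous_ofPairs.matrix_conjTranspose).sub continuous_const)

theorem measure_dominant_le_of_mgf (hL : 0 < L) (H : (Fin N × Fin L → ℂ) → Matrix (Fin N) (Fin N) ℂ)
    (hH : Continuous H)
    (hmgf : ∀ s : ℝ, 0 ≤ s → s < 1 → ∀ x : Fin N → ℂ, ∑ i, ‖x i‖ ^ 2 = 1 →
      ∫⁻ e, ENNReal.ofReal (Real.exp (s * (star x ⬝ᵥ H e *ᵥ x).re))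
        ∂(complexGaussianPi (Fin N × Fin L) 1)
      ≤ ENNReal.ofReal (Real.exp (L * (s ^ 2 / (2 * (1 - s)))))) :
    complexGaussianPi (Fin N × Fin L) 1
        {e | HasDominantEigenvalueGE (H e) (8 * (L * max √((N : ℝ) / L) ((N : ℝ) / L)))}
      ≤ ENNReal.ofReal (Real.exp (-(N : ℝ) / 2)) := by
  set r := √((N : ℝ) / L) with hr
  have hL' : (0 : ℝ) < L := by exact_mod_cast hL
  have hr0 : 0 ≤ r := Real.sqrt_nonneg _
  have hr2 : r ^ 2 = (N : ℝ) / L := Real.sq_sqrt (by positivity)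
  have hLr : L * r ^ 2 = N := by rw [hr2]; field_simp
  -- With `a = 4 L max (r, r²)` and `min (r, 1) max (r, r²) = r²`, this choice gives `s a = 2.6 N`,
  -- while `s²/(2 (1 - s)) ≤ (0.4225 / 0.7) r² ≤ 0.61 r²`.
  set s := 0.65 * min r 1 with hs
  have hm0 : 0 ≤ min r 1 := le_min hr0 zero_le_one
  have hm1 : min r 1 ≤ 1 := min_le_right _ _
  have hs0 : 0 ≤ s := by positivity
  have hs1 : s ≤ 0.65 := by rw [hs]; linarith
  have hsr : s ^ 2 ≤ 0.4225 * r ^ 2 := by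
    have : min r 1 ^ 2 ≤ r ^ 2 := pow_le_pow_left₀ hm0 (min_le_left _ _) 2
    rw [hs, mul_pow]
    norm_num
    linarith
  have hfrac : 0 ≤ s ^ 2 / (2 * (1 - s)) := div_nonneg (sq_nonneg _) (by linarith)
  have h := measure_hasDominantEigenvalueGE_le (complexGaussianPi (Fin N × Fin L) 1) H
    (measurable_matrix_entry hH) (s := s)
    (a := 4 * (L * max r (r ^ 2))) (C := Real.exp (L * (s ^ 2 / (2 * (1 - s))))) hs0
    (Real.one_le_exp (by positivity)) (hmgf s hs0 (by linarith))
  rw [← hr2, show 8 * (L * max r (r ^ 2)) = 2 * (4 * (L * max r (r ^ 2))) by ring]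
  refine h.trans (ENNReal.ofReal_le_ofReal (four_pow_mul_exp_mul_exp_le N ?_ (le_of_eq ?_)))
  · have : s ^ 2 / (2 * (1 - s)) ≤ 0.61 * r ^ 2 := by
      rw [div_le_iff₀ (by linarith)]
      nlinarith [sq_nonneg r]
    rw [← hLr]
    nlinarith
  · have := min_one_mul_max_sq hr0
    rw [← hLr, hs]
    calc 2.6 * (L * r ^ 2) = 2.6 * (L * (min r 1 * max r (r ^ 2))) := by rw [this]
      _ = _ := by ring

theorem measure_weighted_wishart_le {K : ℕ} (hKN : K ≤ N)
    (S : Matrix (Fin K) (Fin L) ℂ) {b : ℝ} (hb : 0 < b)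
    (hS : ∀ x : Fin K → ℂ, ∑ i, ‖x i‖ ^ 2 = 1 → ∑ l, ‖(Sᴴ *ᵥ x) l‖ ^ 2 ≤ b) :
    complexGaussianPi (Fin N × Fin L) 1
        {e | HasDominantEigenvalueGE ((S * (ofPairs e)ᴴ) * (S * (ofPairs e)ᴴ)ᴴ) (9 * N * b)}
      ≤ ENNReal.ofReal (Real.exp (-(N : ℝ) / 2)) := by
  have hcont : Continuous fun e : Fin N × Fin L → ℂ =>
      (S * (ofPairs e)ᴴ) * (S * (ofPairs e)ᴴ)ᴴ := by
    have : Continuous fun e : Fin N × Fin L → ℂ => S * (ofPairs e)ᴴ :=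
      continuous_const.matrix_mul continuous_ofPairs.matrix_conjTranspose
    exact this.matrix_mul this.matrix_conjTranspose
  have h := measure_hasDominantEigenvalueGE_le (complexGaussianPi (Fin N × Fin L) 1)
    (fun e => (S * (ofPairs e)ᴴ) * (S * (ofPairs e)ᴴ)ᴴ) (measurable_matrix_entry hcont)
    -- Since `‖Sᴴ x‖² ≤ b`, this `s` keeps `s ‖Sᴴ x‖²` at most 0.7, inside the domain of the
    -- exponential moment, and `s a = 3.15 N`.
    (s := 0.7 / b) (a := 4.5 * N * b) (C := (1 - 0.7)⁻¹ ^ N) (by positivity)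
    (one_le_pow₀ (by norm_num)) (fun x hx => ?_)
  · rw [show 9 * N * b = 2 * (4.5 * N * b) by ring]
    refine h.trans (ENNReal.ofReal_le_ofReal ?_)
    rw [show 0.7 / b * (4.5 * N * b) = 3.15 * N by field_simp; ring]
    exact four_pow_mul_pow_mul_exp_le hKN
  · have hle : 0.7 / b * ∑ l, ‖(Sᴴ *ᵥ x) l‖ ^ 2 ≤ 0.7 := by
      rw [div_mul_eq_mul_div, div_le_iff₀ hb]
      nlinarith [hS x hx]
    have hint := lintegral_exp_mul_sum_sq_norm_mulVec (N := N) (Sᴴ *ᵥ x) (s := 0.7 / b)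
      (by linarith)
    simp only [conjTranspose_mulVec_dotProduct, Complex.ofReal_re]
    simp only [Matrix.conjTranspose_mul, Matrix.conjTranspose_conjTranspose,
      ← Matrix.mulVec_mulVec]
    refine (le_of_eq hint).trans (ENNReal.ofReal_le_ofReal ?_)
    refine pow_le_pow_left₀ (inv_nonneg.2 (by linarith)) ?_ _
    exact inv_anti₀ (by norm_num) (by linarith)

end Wishart

/-! ### Euclidean and operator norm estimates. -/

section L2

theorem sq_norm_star_dotProduct_le {n : Type*} [Fintype n] (x y : n → ℂ) :
    ‖star x ⬝ᵥ y‖ ^ 2 ≤ (∑ i, ‖x i‖ ^ 2) * ∑ i, ‖y i‖ ^ 2 := by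
  have h := norm_inner_le_norm (𝕜 := ℂ) (WithLp.toLp 2 x) (WithLp.toLp 2 y)
  have h2 := pow_le_pow_left₀ (norm_nonneg _) h 2
  rw [mul_pow, EuclideanSpace.norm_sq_eq, EuclideanSpace.norm_sq_eq,
    EuclideanSpace.inner_eq_star_dotProduct, dotProduct_comm] at h2
  exact h2

variable {m n : Type*} [Fintype m] [Fintype n] [DecidableEq n]

theorem sum_sq_norm_mulVec_le (X : Matrix m n ℂ) (x : n → ℂ) :
    ∑ i, ‖(X *ᵥ x) i‖ ^ 2 ≤ ‖X‖ ^ 2 * ∑ j, ‖x j‖ ^ 2 := by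
  have h := X.l2_opNorm_mulVec (WithLp.toLp 2 x)
  have h2 := pow_le_pow_left₀ (norm_nonneg _) h 2
  rw [mul_pow, EuclideanSpace.norm_sq_eq, EuclideanSpace.norm_sq_eq] at h2
  exact h2

theorem l2_opNorm_le_of_sum_sq_norm_mulVec_le {X : Matrix m n ℂ} {b : ℝ} (hb : 0 ≤ b)
    (h : ∀ x : n → ℂ, ∑ i, ‖(X *ᵥ x) i‖ ^ 2 ≤ b ^ 2 * ∑ j, ‖x j‖ ^ 2) : ‖X‖ ≤ b := by
  rw [Matrix.l2_opNorm_def]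
  refine ContinuousLinearMap.opNorm_le_bound _ hb fun x => ?_
  have h1 := h (WithLp.ofLp x)
  refine le_of_sq_le_sq ?_ (by positivity)
  rw [mul_pow, EuclideanSpace.norm_sq_eq, EuclideanSpace.norm_sq_eq]
  exact h1

theorem norm_star_dotProduct_mulVec_le (X : Matrix n n ℂ) (x : n → ℂ) :
    ‖star x ⬝ᵥ X *ᵥ x‖ ≤ ‖X‖ * ∑ i, ‖x i‖ ^ 2 := by
  refine le_of_sq_le_sq ?_ (by positivity)
  refine (sq_norm_star_dotProduct_le x _).trans ?_
  nlinarith [sum_sq_norm_mulVec_le X x, show 0 ≤ ∑ i, ‖x i‖ ^ 2 by positivity]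

end L2

theorem sum_sq_norm_mulVec_of_isometry {m n : Type*} [Fintype m] [Fintype n] [DecidableEq n]
    {U : Matrix m n ℂ} (hU : Uᴴ * U = 1) (x : n → ℂ) :
    ∑ i, ‖(U *ᵥ x) i‖ ^ 2 = ∑ i, ‖x i‖ ^ 2 := by
  have := sum_sq_norm_conjTranspose_mulVec (V := Uᴴ) (by simpa using hU) x
  simpa using this

/-! ### Weyl's inequality and the sin-theta estimate. -/

section DavisKahan

variable {N K : ℕ} {U : Matrix (Fin N) (Fin K) ℂ}

/-- Weyl's inequality for a perturbation of a positive semidefinite matrix `M` of rank at most `K`: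
the eigenvalues of `M + D` beyond the first `K` are at most `‖D‖` in absolute value. -/
theorem abs_eigenvalue_sub_le {V R M D : Matrix (Fin N) (Fin N) ℂ} {l : Fin N → ℝ} {τ : ℝ}
    (hV : V ∈ Matrix.unitaryGroup (Fin N) ℂ) (hl : Antitone l)
    (hR : R = V * Matrix.diagonal (fun j => (l j : ℂ)) * Vᴴ)
    (hRM : R = M + D + (τ : ℂ) • 1) (hM : ∀ x, 0 ≤ (star x ⬝ᵥ M *ᵥ x).re)
    (hMU : ∀ x, Uᴴ *ᵥ x = 0 → M *ᵥ x = 0) {j : Fin N} (hj : K ≤ j) : |l j - τ| ≤ ‖D‖ := by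
  have hV1 : Vᴴ * V = 1 := (Unitary.mem_iff.1 hV).1
  have hV2 : V * Vᴴ = 1 := (Unitary.mem_iff.1 hV).2
  have hVV : ∀ y : Fin N → ℂ, Vᴴ *ᵥ V *ᵥ y = y := fun y => by
    rw [Matrix.mulVec_mulVec, hV1, Matrix.one_mulVec]
  have hform : ∀ y : Fin N → ℂ, ∑ i, (l i - τ) * ‖y i‖ ^ 2
      = (star (V *ᵥ y) ⬝ᵥ M *ᵥ V *ᵥ y).re + (star (V *ᵥ y) ⬝ᵥ D *ᵥ V *ᵥ y).re := by
    intro y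
    have h1 := star_dotProduct_mulVec_of_spectral hR (V *ᵥ y)
    rw [hVV] at h1
    rw [hRM, Matrix.add_mulVec, Matrix.add_mulVec, dotProduct_add, dotProduct_add,
      Matrix.smul_mulVec, Matrix.one_mulVec, dotProduct_smul, star_dotProduct_self,
      sum_sq_norm_mulVec_of_isometry hV1] at h1
    have h2 := congrArg Complex.re h1
    rw [Complex.add_re, Complex.add_re, smul_eq_mul, Complex.re_ofReal_mul, Complex.ofReal_re,
      Complex.ofReal_re] at h2
    simp only [sub_mul, Finset.sum_sub_distrib, ← Finset.mul_sum]
    linarith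
  have hDle : ∀ y : Fin N → ℂ, |(star (V *ᵥ y) ⬝ᵥ D *ᵥ V *ᵥ y).re| ≤ ‖D‖ * ∑ i, ‖y i‖ ^ 2 := by
    intro y
    rw [← sum_sq_norm_mulVec_of_isometry hV1 y]
    exact (Complex.abs_re_le_norm _).trans (norm_star_dotProduct_mulVec_le D _)
  rw [abs_le]
  constructor
  -- Lower bound: test on the eigenvector of `l j`, where the form of `M` is nonnegative.
  · have h1 := hform (Pi.single j 1)
    have h2 := (abs_le.1 (hDle (Pi.single j 1))).1
    have h3 := hM (V *ᵥ Pi.single j 1)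
    have e1 : ∀ i : Fin N, ‖(Pi.single j (1 : ℂ) : Fin N → ℂ) i‖ ^ 2 = if i = j then 1 else 0 := by
      intro i
      by_cases h : i = j
      · subst h; simp
      · simp [h]
    simp only [e1, mul_ite, mul_one, mul_zero, Finset.sum_ite_eq', Finset.mem_univ, if_true] at h1 h2
    linarith
  -- Upper bound by dimension count: killing `Uᴴ V y` and all coordinates beyond `j` imposes `K + (N
  -- - 1 - j) < N` conditions. A nonzero `y` remains, on which `M` vanishes and the form of `R - τ`
  -- is at least `(l j - τ) ‖y‖²`.
  · let f : (Fin N → ℂ) →ₗ[ℂ] (Fin K → ℂ) × ({i : Fin N // j < i} → ℂ) :=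
      (Matrix.mulVecLin (Uᴴ * V)).prod (LinearMap.funLeft ℂ ℂ Subtype.val)
    have hker : LinearMap.ker f ≠ ⊥ := by
      refine LinearMap.ker_ne_bot_of_finrank_lt ?_
      rw [Module.finrank_prod, Module.finrank_fin_fun, Module.finrank_fin_fun,
        Module.finrank_fintype_fun_eq_card]
      have : Fintype.card {i : Fin N // j < i} = N - 1 - j := by
        rw [Fintype.card_subtype, ← Fin.card_Ioi]
        congr 1
        ext i
        simp
      have := j.isLt
      omega
    obtain ⟨y, hy, hy0⟩ := (Submodule.ne_bot_iff _).1 hker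
    have hf := LinearMap.mem_ker.1 hy
    have hf1 : Uᴴ *ᵥ V *ᵥ y = 0 := by
      have := congrArg Prod.fst hf
      simpa [f] using this
    have hf2 : ∀ i, j < i → y i = 0 := fun i hi => by
      have := congrFun (congrArg Prod.snd hf) ⟨i, hi⟩
      simpa [f, LinearMap.funLeft] using this
    have hpos : 0 < ∑ i, ‖y i‖ ^ 2 := by
      obtain ⟨i, hi⟩ := Function.ne_iff.1 hy0
      exact Finset.sum_pos' (fun _ _ => by positivity)
        ⟨i, Finset.mem_univ _, by have := norm_pos_iff.2 hi; positivity⟩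
    have h1 := hform y
    rw [hMU _ hf1] at h1
    have h2 := (abs_le.1 (hDle y)).2
    have h3 : (l j - τ) * ∑ i, ‖y i‖ ^ 2 ≤ ∑ i, (l i - τ) * ‖y i‖ ^ 2 := by
      rw [Finset.mul_sum]
      refine Finset.sum_le_sum fun i _ => ?_
      rcases lt_or_ge j i with h | h
      · simp [hf2 i h]
      · exact mul_le_mul_of_nonneg_right (by linarith [hl h]) (by positivity)
    simp only [dotProduct_zero, Complex.zero_re, zero_add] at h1
    exact le_of_mul_le_mul_right (by linarith) hpos

/-- The matrix of the orthogonal projection onto the span of the columns of the unitary matrix `V`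
beyond the first `K`. -/
noncomputable def tailProj (K : ℕ) (V : Matrix (Fin N) (Fin N) ℂ) : Matrix (Fin N) (Fin N) ℂ :=
  V * Matrix.diagonal (fun j : Fin N => ((if K ≤ (j : ℕ) then 1 else 0 : ℝ) : ℂ)) * Vᴴ

theorem norm_tailProj_mul_le {V R M D : Matrix (Fin N) (Fin N) ℂ} {l : Fin N → ℝ} {τ η δ : ℝ}
    (hV : V ∈ Matrix.unitaryGroup (Fin N) ℂ) (hl : Antitone l)
    (hR : R = V * Matrix.diagonal (fun j => (l j : ℂ)) * Vᴴ)
    (hRM : R = M + D + (τ : ℂ) • 1) (hU : Uᴴ * U = 1) {G : Matrix (Fin K) (Fin K) ℂ}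
    (hM : M = U * G * Uᴴ) (hGpos : G.PosDef) (hδ : 0 < δ) (hG : ∀ z, δ * ∑ i, ‖z i‖ ^ 2 ≤ (star z ⬝ᵥ G *ᵥ z).re)
    (hD : ‖D‖ ≤ η) :
    ‖tailProj K V * U‖ * (δ - η) ≤ η := by
  have hV1 : Vᴴ * V = 1 := (Unitary.mem_iff.1 hV).1
  have hV2 : V * Vᴴ = 1 := (Unitary.mem_iff.1 hV).2
  have hη : 0 ≤ η := (norm_nonneg D).trans hD
  set P := tailProj K V with hP
  set T := V * Matrix.diagonal (fun j : Fin N => ((if K ≤ (j : ℕ) then l j - τ else 0 : ℝ) : ℂ)) * Vᴴ with hT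
  have hPnorm : ‖P‖ ≤ 1 := l2_opNorm_le_of_spectral hV rfl zero_le_one fun i => by
    split_ifs <;> simp
  have hTnorm : ‖T‖ ≤ η := by
    refine l2_opNorm_le_of_spectral hV rfl hη fun i => ?_
    split_ifs with h
    · refine (abs_eigenvalue_sub_le (U := U) hV hl hR hRM (fun x => ?_) (fun x hx => ?_) h).trans hD
      · have h1 := hGpos.posSemidef.dotProduct_mulVec_nonneg (Uᴴ *ᵥ x)
        have h2 : star x ⬝ᵥ M *ᵥ x = star (Uᴴ *ᵥ x) ⬝ᵥ G *ᵥ Uᴴ *ᵥ x := by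
          rw [hM, ← Matrix.mulVec_mulVec, ← Matrix.mulVec_mulVec, Matrix.star_mulVec,
            Matrix.conjTranspose_conjTranspose, ← Matrix.dotProduct_mulVec]
        rw [h2]
        exact (Complex.le_def.1 h1).1
      · rw [hM, ← Matrix.mulVec_mulVec, hx, Matrix.mulVec_zero]
    · simpa using hη
  have hsub : R - (τ : ℂ) • 1 = V * Matrix.diagonal (fun j => ((l j - τ : ℝ) : ℂ)) * Vᴴ := by
    have h1 : Matrix.diagonal (fun j => ((l j - τ : ℝ) : ℂ))
        = Matrix.diagonal (fun j => (l j : ℂ)) - (τ : ℂ) • (1 : Matrix (Fin N) (Fin N) ℂ) := by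
      ext i j
      by_cases h : i = j
      · subst h; simp
      · simp [h]
    rw [h1, mul_sub, sub_mul, ← hR, Matrix.mul_smul, mul_one, Matrix.smul_mul,
      hV2]
  have hdiag : ∀ a b : Fin N → ℂ, (V * Matrix.diagonal a * Vᴴ) * (V * Matrix.diagonal b * Vᴴ)
      = V * Matrix.diagonal (fun i => a i * b i) * Vᴴ := by
    intro a b
    rw [← Matrix.diagonal_mul_diagonal]
    simp only [Matrix.mul_assoc]
    rw [← Matrix.mul_assoc Vᴴ V, hV1, Matrix.one_mul]
  have hPR : P * (R - (τ : ℂ) • 1) = T * P := by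
    rw [hsub, hP, tailProj, hT, hdiag, hdiag]
    congr 3
    ext i
    split_ifs <;> simp
  have hMU : M * U = U * G := by
    rw [hM, Matrix.mul_assoc, hU, Matrix.mul_one]
  -- A Sylvester-type equation for `P U`: `G` is bounded below by `δ` and `T` above by `η`, so
  -- multiplying by `G⁻¹` makes `P U` small.
  have hkey : (P * U) * G = T * (P * U) - P * D * U := by
    have : M = (R - (τ : ℂ) • 1) - D := by rw [hRM]; abel
    rw [Matrix.mul_assoc, ← hMU, this, ← Matrix.mul_assoc, mul_sub, hPR, Matrix.sub_mul,
      Matrix.mul_assoc]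
  have hUnorm : ‖U‖ ≤ 1 := l2_opNorm_le_of_sum_sq_norm_mulVec_le zero_le_one fun x => by
    rw [sum_sq_norm_mulVec_of_isometry hU]; simp
  have hGinv : G * G⁻¹ = 1 := Matrix.mul_nonsing_inv _ ((Matrix.isUnit_iff_isUnit_det _).1 hGpos.isUnit)
  -- With `x = G z`, coercivity and Cauchy–Schwarz give `δ ‖z‖² ≤ |zᴴ x| ≤ ‖z‖ ‖x‖`.
  have hGnorm : ‖G⁻¹‖ ≤ δ⁻¹ := by
    refine l2_opNorm_le_of_sum_sq_norm_mulVec_le (by positivity) fun x => ?_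
    set z := G⁻¹ *ᵥ x with hz
    have hx : G *ᵥ z = x := by rw [hz, Matrix.mulVec_mulVec, hGinv, Matrix.one_mulVec]
    have h1 := hG z
    rw [hx] at h1
    have h2 := sq_norm_star_dotProduct_le z x
    have h3 : (δ * ∑ i, ‖z i‖ ^ 2) ^ 2 ≤ (∑ i, ‖z i‖ ^ 2) * ∑ i, ‖x i‖ ^ 2 :=
      (pow_le_pow_left₀ (by positivity) (h1.trans ((le_abs_self _).trans
        (Complex.abs_re_le_norm _))) 2).trans h2
    rw [inv_pow, inv_mul_eq_div, le_div_iff₀ (by positivity)]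
    rcases (show 0 ≤ ∑ i, ‖z i‖ ^ 2 by positivity).eq_or_lt with h0 | h0
    · rw [← h0, zero_mul]; positivity
    · refine le_of_mul_le_mul_left ?_ h0
      nlinarith
  have hPU : P * U = (T * (P * U) - P * D * U) * G⁻¹ := by
    rw [← hkey, Matrix.mul_assoc, hGinv, Matrix.mul_one]
  have h1 : ‖P * D * U‖ ≤ η := by
    calc ‖P * D * U‖ ≤ ‖P * D‖ * ‖U‖ := Matrix.l2_opNorm_mul _ _
      _ ≤ (‖P‖ * ‖D‖) * ‖U‖ := by gcongr; exact Matrix.l2_opNorm_mul _ _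
      _ ≤ (1 * η) * 1 := by gcongr
      _ = η := by ring
  have h2 : ‖T * (P * U)‖ ≤ η * ‖P * U‖ :=
    (Matrix.l2_opNorm_mul _ _).trans (by gcongr)
  have h3 : ‖P * U‖ ≤ (η * ‖P * U‖ + η) * δ⁻¹ := by
    calc ‖P * U‖ = ‖(T * (P * U) - P * D * U) * G⁻¹‖ := by rw [← hPU]
      _ ≤ ‖T * (P * U) - P * D * U‖ * ‖G⁻¹‖ := Matrix.l2_opNorm_mul _ _
      _ ≤ (η * ‖P * U‖ + η) * δ⁻¹ := by
        gcongr
        exact (norm_sub_le _ _).trans (add_le_add h2 h1)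
  rw [← div_eq_mul_inv, le_div_iff₀ hδ] at h3
  linarith

end DavisKahan

/-! ### Canonical angles, singular values and extreme eigenvalues. -/

theorem sum_sq_norm_conjTranspose_mulVec_add_tailProj {N K : ℕ} (hKN : K ≤ N)
    {V : Matrix (Fin N) (Fin N) ℂ} (hV : V ∈ Matrix.unitaryGroup (Fin N) ℂ) (x : Fin N → ℂ) :
    ∑ i, ‖((V.submatrix id (Fin.castLE hKN))ᴴ *ᵥ x) i‖ ^ 2 + ∑ i, ‖(tailProj K V *ᵥ x) i‖ ^ 2
      = ∑ i, ‖x i‖ ^ 2 := by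
  have hV1 : Vᴴ * V = 1 := (Unitary.mem_iff.1 hV).1
  have hV2 : V * Vᴴ = 1 := (Unitary.mem_iff.1 hV).2
  set y := Vᴴ *ᵥ x with hy
  have h1 : ∑ i, ‖(tailProj K V *ᵥ x) i‖ ^ 2
      = ∑ i : Fin N, if K ≤ (i : ℕ) then ‖y i‖ ^ 2 else 0 := by
    rw [tailProj, ← Matrix.mulVec_mulVec, ← Matrix.mulVec_mulVec,
      sum_sq_norm_mulVec_of_isometry hV1]
    refine Finset.sum_congr rfl fun i _ => ?_
    rw [Matrix.mulVec_diagonal]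
    split_ifs <;> simp [hy]
  have h2 : ∑ i, ‖((V.submatrix id (Fin.castLE hKN))ᴴ *ᵥ x) i‖ ^ 2
      = ∑ i : Fin N, if K ≤ (i : ℕ) then 0 else ‖y i‖ ^ 2 := by
    have : ∀ i, ((V.submatrix id (Fin.castLE hKN))ᴴ *ᵥ x) i = y (Fin.castLE hKN i) := by
      intro i
      simp [hy, Matrix.mulVec, dotProduct]
    simp_rw [this]
    simp_rw [← ite_not (K ≤ _)]
    rw [← Finset.sum_filter]
    refine Finset.sum_bij (fun i _ => Fin.castLE hKN i) ?_ ?_ ?_ ?_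
    · intro i _; simp
    · intro i _ j _ h; exact Fin.castLE_injective hKN h
    · intro b hb
      have hb' : (b : ℕ) < K := by simpa using hb
      exact ⟨⟨b, hb'⟩, Finset.mem_univ _, rfl⟩
    · intro i _; rfl
  rw [h1, h2, ← sum_sq_norm_conjTranspose_mulVec hV2 x, ← Finset.sum_add_distrib]
  refine Finset.sum_congr rfl fun i _ => ?_
  split_ifs <;> simp [hy]

theorem exists_sum_sq_norm_mulVec_eq_singularValue {m n : ℕ} (X : Matrix (Fin m) (Fin n) ℂ)
    (j : Fin n) : ∃ z : Fin n → ℂ, ∑ i, ‖z i‖ ^ 2 = 1 ∧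
      ∑ i, ‖(X *ᵥ z) i‖ ^ 2 = singularValue X (j + 1) ^ 2 := by
  set T := Matrix.toEuclideanLin X with hT
  have hn : Module.finrank ℂ (EuclideanSpace ℂ (Fin n)) = n := by simp
  set hsym := T.isSymmetric_adjoint_comp_self
  have hb := hsym.apply_eigenvectorBasis hn j
  set b := hsym.eigenvectorBasis hn
  refine ⟨WithLp.ofLp (b j), ?_, ?_⟩
  · have := b.norm_eq_one j
    rw [← EuclideanSpace.norm_sq_eq, this, one_pow]
  · have h1 : ‖T (b j)‖ ^ 2 = ∑ i, ‖(X *ᵥ WithLp.ofLp (b j)) i‖ ^ 2 := by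
      rw [EuclideanSpace.norm_sq_eq]; rfl
    have h2 : ((‖T (b j)‖ ^ 2 : ℝ) : ℂ) = ((T.singularValues j ^ 2 : ℝ) : ℂ) := by
      rw [T.sq_singularValues_fin hn j, Complex.ofReal_pow]
      have h3 := inner_self_eq_norm_sq_to_K (𝕜 := ℂ) (T (b j))
      rw [← LinearMap.adjoint_inner_right] at h3
      have h4 : LinearMap.adjoint T (T (b j)) = (hsym.eigenvalues hn j : ℂ) • b j := hb
      rw [h4, inner_smul_right, inner_self_eq_norm_sq_to_K, b.norm_eq_one] at h3
      simpa using h3.symm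
    rw [← h1]
    simp only [singularValue, Nat.add_sub_cancel]
    exact_mod_cast h2

theorem singularValue_sq_mul_le {m n : ℕ} (hn0 : 1 ≤ n) (X : Matrix (Fin m) (Fin n) ℂ)
    (x : Fin n → ℂ) :
    singularValue X n ^ 2 * ∑ i, ‖x i‖ ^ 2 ≤ ∑ i, ‖(X *ᵥ x) i‖ ^ 2 := by
  set T := Matrix.toEuclideanLin X with hT
  have hn : Module.finrank ℂ (EuclideanSpace ℂ (Fin n)) = n := by simp
  set hsym := T.isSymmetric_adjoint_comp_self
  set b := hsym.eigenvectorBasis hn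
  set x' : EuclideanSpace ℂ (Fin n) := WithLp.toLp 2 x
  have h1 : ‖T x'‖ ^ 2 = ∑ i, ‖(X *ᵥ x) i‖ ^ 2 := by
    rw [EuclideanSpace.norm_sq_eq]; rfl
  have h2 : ‖x'‖ ^ 2 = ∑ i, ‖x i‖ ^ 2 := by
    rw [EuclideanSpace.norm_sq_eq]
  have h3 : ((‖T x'‖ ^ 2 : ℝ) : ℂ)
      = ((∑ i, hsym.eigenvalues hn i * ‖inner ℂ (b i) x'‖ ^ 2 : ℝ) : ℂ) := by
    have h4 := inner_self_eq_norm_sq_to_K (𝕜 := ℂ) (T x')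
    rw [← LinearMap.adjoint_inner_right, ← b.sum_inner_mul_inner] at h4
    rw [Complex.ofReal_pow]
    refine h4.symm.trans ?_
    push_cast
    refine Finset.sum_congr rfl fun i _ => ?_
    have h5 : inner ℂ (b i) (LinearMap.adjoint T (T x'))
        = (hsym.eigenvalues hn i : ℂ) * inner ℂ (b i) x' := by
      have h6 : LinearMap.adjoint T (T (b i)) = (hsym.eigenvalues hn i : ℂ) • b i :=
        hsym.apply_eigenvectorBasis hn i
      have h7 := hsym (b i) x'
      simp only [LinearMap.comp_apply] at h7
      rw [← h7, h6, inner_smul_left, Complex.conj_ofReal]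
    rw [h5, ← inner_conj_symm x' (b i), ← Complex.conj_mul']
    ring
  have h4 : ‖T x'‖ ^ 2 = ∑ i, hsym.eigenvalues hn i * ‖inner ℂ (b i) x'‖ ^ 2 := by
    exact_mod_cast h3
  rw [← h1, h4, ← h2, ← b.sum_sq_norm_inner_right x', Finset.mul_sum]
  refine Finset.sum_le_sum fun i _ => mul_le_mul_of_nonneg_right ?_ (by positivity)
  rw [← T.sq_singularValues_fin hn i]
  exact pow_le_pow_left₀ (T.singularValues_nonneg _)
    (T.singularValues_antitone (by have := i.isLt; omega)) 2

theorem eigenvalueDesc_mul_le {n : ℕ} (hn : 1 ≤ n) {M : Matrix (Fin n) (Fin n) ℂ}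
    (hM : M.IsHermitian) (x : Fin n → ℂ) :
    eigenvalueDesc hM ⟨n - 1, Nat.sub_one_lt_of_lt hn⟩ * ∑ i, ‖x i‖ ^ 2
      ≤ (star x ⬝ᵥ M *ᵥ x).re := by
  obtain ⟨V, hV, hMV⟩ := exists_spectral_of_isHermitian hM
  rw [star_dotProduct_mulVec_of_spectral hMV, Complex.ofReal_re,
    ← sum_sq_norm_conjTranspose_mulVec (Unitary.mem_iff.1 hV).2, Finset.mul_sum]
  refine Finset.sum_le_sum fun i _ => mul_le_mul_of_nonneg_right ?_ (by positivity)
  -- `eigenvalues i` is by definition `eigenvalues₀` at a reindexed position, which is at most `n -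
  -- 1`.
  refine hM.eigenvalues₀_antitone ?_
  rw [Fin.le_def]
  have := lt_of_lt_of_eq ((Fintype.equivOfCardEq (Fintype.card_fin (Fintype.card (Fin n)))).symm
    i).isLt (Fintype.card_fin n)
  exact Nat.le_sub_one_of_lt this

theorem eigenvalueDesc_pos {n : ℕ} {M : Matrix (Fin n) (Fin n) ℂ} (hM : M.PosDef) (j : Fin n) :
    0 < eigenvalueDesc hM.isHermitian j := by
  have h := hM.eigenvalues_pos
    (Fintype.equivOfCardEq (Fintype.card_fin (Fintype.card (Fin n)))
      (Fin.cast (Fintype.card_fin n).symm j))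
  simpa [Matrix.IsHermitian.eigenvalues, eigenvalueDesc] using h

/-- For a unit right singular vector `z` of `Ûᴴ U`, Pythagoras gives `sin² θ_j = 1 - ‖Ûᴴ U z‖² = ‖P
U z‖²`. -/
theorem subspaceDist_le_norm_tailProj_mul {N K : ℕ} (hKN : K ≤ N)
    {V : Matrix (Fin N) (Fin N) ℂ} (hV : V ∈ Matrix.unitaryGroup (Fin N) ℂ)
    {U : Matrix (Fin N) (Fin K) ℂ} (hU : Uᴴ * U = 1) :
    subspaceDist (V.submatrix id (Fin.castLE hKN)) U ≤ ‖tailProj K V * U‖ := by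
  unfold subspaceDist
  rw [Matrix.l2_opNorm_diagonal, pi_norm_le_iff_of_nonneg (norm_nonneg _)]
  intro j
  obtain ⟨z, hz, hzs⟩ := exists_sum_sq_norm_mulVec_eq_singularValue
    ((V.submatrix id (Fin.castLE hKN))ᴴ * U) j
  have h1 := sum_sq_norm_conjTranspose_mulVec_add_tailProj hKN hV (U *ᵥ z)
  rw [Matrix.mulVec_mulVec, hzs, sum_sq_norm_mulVec_of_isometry hU, hz, Matrix.mulVec_mulVec] at h1
  have h2 := sum_sq_norm_mulVec_le (tailProj K V * U) z
  rw [hz, mul_one] at h2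
  rw [canonicalAngle, Real.sin_arccos, Real.norm_eq_abs, abs_of_nonneg (Real.sqrt_nonneg _)]
  exact Real.sqrt_le_left (norm_nonneg _) |>.2 (by linarith)

/-- The range of `A` is that of an isometry on `ℂ^K`, so `A` has rank `K` and is injective. -/
theorem singularValue_pos_of_isOrthonormalBasisOfRange {N K : ℕ} (hK : 1 ≤ K)
    {A U : Matrix (Fin N) (Fin K) ℂ} (hU : IsOrthonormalBasisOfRange A U) :
    0 < singularValue A K := by
  have hrU : Module.finrank ℂ (LinearMap.range U.mulVecLin) = K := by
    rw [LinearMap.finrank_range_of_inj, Module.finrank_fin_fun]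
    intro x y hxy
    have h := congrArg (fun v => Uᴴ *ᵥ v) hxy
    simpa [Matrix.mulVec_mulVec, hU.1] using h
  have hinj : Function.Injective (Matrix.toEuclideanLin A) := by
    have h1 : LinearMap.ker A.mulVecLin = ⊥ := by
      have h2 := LinearMap.finrank_range_add_finrank_ker A.mulVecLin
      rw [← hU.2, hrU, Module.finrank_fin_fun] at h2
      exact Submodule.finrank_eq_zero.1 (by omega)
    intro x y hxy
    have h3 := LinearMap.ker_eq_bot.1 h1 (a₁ := WithLp.ofLp x) (a₂ := WithLp.ofLp y)
      (congrArg WithLp.ofLp hxy)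
    exact (WithLp.ofLp_injective 2) h3
  exact (LinearMap.injective_iff_forall_lt_finrank_singularValues_pos _).1 hinj (K - 1)
    (by rw [finrank_euclideanSpace_fin]; omega)

theorem exists_eq_mul_of_isOrthonormalBasisOfRange {N K : ℕ}
    {A U : Matrix (Fin N) (Fin K) ℂ} (hU : IsOrthonormalBasisOfRange A U) :
    (U * Uᴴ * A = A) ∧ ∀ z, ∃ x, U *ᵥ z = A *ᵥ x := by
  constructor
  · refine Matrix.ext_of_mulVec_single fun k => ?_
    have : A *ᵥ Pi.single k 1 ∈ LinearMap.range U.mulVecLin := by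
      rw [hU.2]; exact ⟨_, rfl⟩
    obtain ⟨c, hc⟩ := this
    rw [Matrix.mulVecLin_apply] at hc
    rw [← Matrix.mulVec_mulVec, ← hc, Matrix.mulVec_mulVec, Matrix.mul_assoc, hU.1, Matrix.mul_one]
  · intro z
    have : U *ᵥ z ∈ LinearMap.range A.mulVecLin := by
      rw [← hU.2]; exact ⟨_, rfl⟩
    obtain ⟨x, hx⟩ := this
    exact ⟨x, hx.symm⟩

/-- On its own range `Aᴴ` is as well conditioned as `A`. If `U z = A x`, then `‖z‖² = xᴴ Aᴴ U z ≤
‖x‖ ‖Aᴴ U z‖`, while `σ_K(A) ‖x‖ ≤ ‖A x‖ = ‖z‖`. -/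
theorem singularValue_sq_mul_le_of_mem_range {N K : ℕ} (hK : 1 ≤ K)
    {A U : Matrix (Fin N) (Fin K) ℂ} (hU : IsOrthonormalBasisOfRange A U) (z : Fin K → ℂ) :
    singularValue A K ^ 2 * ∑ i, ‖z i‖ ^ 2 ≤ ∑ i, ‖(Aᴴ *ᵥ U *ᵥ z) i‖ ^ 2 := by
  obtain ⟨x, hx⟩ := (exists_eq_mul_of_isOrthonormalBasisOfRange hU).2 z
  have h1 := singularValue_sq_mul_le hK A x
  rw [← hx, sum_sq_norm_mulVec_of_isometry hU.1] at h1
  have h2 := sq_norm_star_dotProduct_le x (Aᴴ *ᵥ U *ᵥ z)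
  have h3 : star x ⬝ᵥ (Aᴴ *ᵥ U *ᵥ z) = ((∑ i, ‖z i‖ ^ 2 : ℝ) : ℂ) := by
    rw [Matrix.dotProduct_mulVec, ← Matrix.star_mulVec, ← hx, star_dotProduct_self,
      sum_sq_norm_mulVec_of_isometry hU.1]
  rw [h3, Complex.norm_real, Real.norm_eq_abs, sq_abs] at h2
  set q := ∑ i, ‖z i‖ ^ 2
  set p := ∑ i, ‖x i‖ ^ 2
  set w := ∑ i, ‖(Aᴴ *ᵥ U *ᵥ z) i‖ ^ 2
  have hq : 0 ≤ q := by positivity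
  have hp : 0 ≤ p := by positivity
  have hw : 0 ≤ w := by positivity
  rcases hq.eq_or_lt with h0 | h0
  · rw [← h0, mul_zero]; exact hw
  · refine le_of_mul_le_mul_right ?_ h0
    have := mul_le_mul_of_nonneg_right h1 hw
    have h4 := mul_le_mul_of_nonneg_left h2 (sq_nonneg (singularValue A K))
    nlinarith

/-! ### The good event for the noise. -/

section GoodEvent

variable {N K L : ℕ}

/-- The event on which the noise matrix `e` is well-conditioned. -/
def noiseEvent (S : Matrix (Fin K) (Fin L) ℂ) (σ : ℝ) : Set (Fin N × Fin L → ℂ) :=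
  {e | ‖ofPairs e * (ofPairs e)ᴴ - ((σ ^ 2 * L : ℝ) : ℂ) • (1 : Matrix (Fin N) (Fin N) ℂ)‖
        ≤ σ ^ 2 * (8 * (L * max √((N : ℝ) / L) ((N : ℝ) / L))) ∧
      ‖S * (ofPairs e)ᴴ‖ ≤ σ * (3 * √N * ‖S‖)}

theorem measurableSet_noiseEvent (S : Matrix (Fin K) (Fin L) ℂ) (σ : ℝ) :
    MeasurableSet (noiseEvent S σ : Set (Fin N × Fin L → ℂ)) := by
  have h1 : Continuous fun e : Fin N × Fin L → ℂ =>
      ofPairs e * (ofPairs e)ᴴ - ((σ ^ 2 * L : ℝ) : ℂ) • (1 : Matrix (Fin N) (Fin N) ℂ) :=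
    (continuous_ofPairs.matrix_mul continuous_ofPairs.matrix_conjTranspose).sub continuous_const
  have h2 : Continuous fun e : Fin N × Fin L → ℂ => S * (ofPairs e)ᴴ :=
    continuous_const.matrix_mul continuous_ofPairs.matrix_conjTranspose
  exact ((isClosed_le h1.norm continuous_const).inter
    (isClosed_le h2.norm continuous_const)).measurableSet

theorem sq_l2_opNorm_eq_mul_conjTranspose (X : Matrix (Fin K) (Fin L) ℂ) :
    ‖X‖ ^ 2 = ‖X * Xᴴ‖ := by
  have := Matrix.l2_opNorm_conjTranspose_mul_self Xᴴ
  rw [Matrix.conjTranspose_conjTranspose, Matrix.l2_opNorm_conjTranspose] at this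
  rw [this, sq]

theorem complexGaussianPi_one_compl_noiseEvent_le (hKN : K ≤ N) (hL : 0 < L)
    (S : Matrix (Fin K) (Fin L) ℂ) (hS : 0 < ‖S‖) :
    complexGaussianPi (Fin N × Fin L) 1 (noiseEvent S 1)ᶜ
      ≤ 3 * ENNReal.ofReal (Real.exp (-(N : ℝ) / 2)) := by
  set b := 8 * (L * max √((N : ℝ) / L) ((N : ℝ) / L)) with hb
  have h1 := measure_dominant_le_of_mgf (N := N) hL _ continuous_wishart
    (fun s h0 h1 x hx => wishart_mgf_le hx h0 h1)
  have h2 := measure_dominant_le_of_mgf (N := N) hL _ continuous_wishart.neg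
    (fun s h0 h1 x hx => neg_wishart_mgf_le hx h0 h1)
  have h3 := measure_weighted_wishart_le hKN S (b := ‖S‖ ^ 2) (by positivity) fun x hx => by
    have := sum_sq_norm_mulVec_le Sᴴ x
    rwa [hx, mul_one, Matrix.l2_opNorm_conjTranspose] at this
  rw [← hb] at h1 h2
  have hsub : (noiseEvent S 1)ᶜ
      ⊆ ({e : Fin N × Fin L → ℂ |
            HasDominantEigenvalueGE (ofPairs e * (ofPairs e)ᴴ - (L : ℂ) • 1) b}
        ∪ {e | HasDominantEigenvalueGE (-(ofPairs e * (ofPairs e)ᴴ - (L : ℂ) • 1)) b})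
        ∪ {e | HasDominantEigenvalueGE ((S * (ofPairs e)ᴴ) * (S * (ofPairs e)ᴴ)ᴴ)
            (9 * N * ‖S‖ ^ 2)} := by
    intro e he
    by_contra hcon
    simp only [Set.mem_union, Set.mem_ofPred_eq, not_or] at hcon
    refine he ⟨?_, ?_⟩
    · have hherm : (ofPairs e * (ofPairs e)ᴴ - (L : ℂ) • 1).IsHermitian := by
        refine (Matrix.isHermitian_mul_conjTranspose_self _).sub ?_
        unfold Matrix.IsHermitian
        rw [Matrix.conjTranspose_smul, Matrix.conjTranspose_one]
        simp
      have := l2_opNorm_le_of_not_hasDominantEigenvalueGE hherm (by positivity) hcon.1.1 hcon.1.2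
      have hone : ((1 ^ 2 * L : ℝ) : ℂ) = L := by simp
      rw [hone, one_pow, one_mul, ← hb]
      exact this
    · have := l2_opNorm_le_of_posSemidef_of_not_hasDominantEigenvalueGE
        (Matrix.posSemidef_self_mul_conjTranspose _) (by positivity) hcon.2
      rw [← sq_l2_opNorm_eq_mul_conjTranspose] at this
      rw [one_mul]
      refine le_of_sq_le_sq (this.trans (le_of_eq ?_)) (by positivity)
      rw [mul_pow, mul_pow, Real.sq_sqrt (by positivity)]
      ring
  refine (measure_mono hsub).trans ((measure_union_le _ _).trans ?_)
  refine (add_le_add ((measure_union_le _ _).trans (add_le_add h1 h2)) h3).trans (le_of_eq ?_)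
  ring

theorem complexGaussianPi_compl_noiseEvent_le (hKN : K ≤ N) (hL : 0 < L)
    (S : Matrix (Fin K) (Fin L) ℂ) (hS : 0 < ‖S‖) {σ : ℝ} (hσ : 0 ≤ σ) :
    complexGaussianPi (Fin N × Fin L) σ (noiseEvent S σ)ᶜ
      ≤ 3 * ENNReal.ofReal (Real.exp (-(N : ℝ) / 2)) := by
  -- The case of general `σ`, including `σ = 0`, is the image of unit noise under scaling, and the
  -- bounds defining the event scale with it.
  rw [complexGaussianPi_eq_map_smul, Measure.map_apply (by fun_prop)
    (measurableSet_noiseEvent S σ).compl]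
  refine (measure_mono ?_).trans (complexGaussianPi_one_compl_noiseEvent_le hKN hL S hS)
  rw [Set.preimage_compl, Set.compl_subset_compl]
  rintro e ⟨h1, h2⟩
  have he : ofPairs ((σ : ℂ) • e) = (σ : ℂ) • ofPairs e := rfl
  refine ⟨?_, ?_⟩
  · have h3 : ofPairs ((σ : ℂ) • e) * (ofPairs ((σ : ℂ) • e))ᴴ - ((σ ^ 2 * L : ℝ) : ℂ) • 1
        = ((σ ^ 2 : ℝ) : ℂ) • (ofPairs e * (ofPairs e)ᴴ - ((1 ^ 2 * L : ℝ) : ℂ) • 1) := by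
      rw [he, Matrix.conjTranspose_smul, Matrix.smul_mul, Matrix.mul_smul, smul_smul, smul_sub,
        smul_smul]
      simp [sq]
    rw [h3, norm_smul, Complex.norm_real, Real.norm_eq_abs, abs_of_nonneg (sq_nonneg σ)]
    rw [one_pow, one_mul] at h1
    exact mul_le_mul_of_nonneg_left (by simpa using h1) (sq_nonneg σ)
  · rw [he, Matrix.conjTranspose_smul, Matrix.mul_smul, norm_smul]
    rw [one_mul] at h2
    simpa [abs_of_nonneg hσ] using mul_le_mul_of_nonneg_left h2 hσ

end GoodEvent

/-! ### Decomposition of the sample covariance and conclusion. -/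

theorem sampleCov_add_eq {N K L : ℕ} (hL : 0 < L) (A : Matrix (Fin N) (Fin K) ℂ)
    (S : Matrix (Fin K) (Fin L) ℂ) (W : Matrix (Fin N) (Fin L) ℂ) (σ : ℝ) :
    sampleCov (A * S + W) = A * sampleCov S * Aᴴ
      + (1 / (L : ℂ)) • (A * (S * Wᴴ) + (A * (S * Wᴴ))ᴴ
          + (W * Wᴴ - ((σ ^ 2 * L : ℝ) : ℂ) • (1 : Matrix (Fin N) (Fin N) ℂ)))
      + ((σ ^ 2 : ℝ) : ℂ) • 1 := by
  have hL' : (L : ℂ) ≠ 0 := by exact_mod_cast hL.ne'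
  have h1 : ((σ ^ 2 : ℝ) : ℂ) • (1 : Matrix (Fin N) (Fin N) ℂ)
      = (1 / (L : ℂ)) • ((σ ^ 2 * L : ℝ) : ℂ) • (1 : Matrix (Fin N) (Fin N) ℂ) := by
    rw [smul_smul]
    congr 1
    push_cast
    field_simp
  rw [h1]
  unfold sampleCov
  rw [Matrix.mul_smul, Matrix.smul_mul, ← smul_add, ← smul_add]
  congr 1
  simp only [Matrix.conjTranspose_add, Matrix.conjTranspose_mul, Matrix.add_mul, Matrix.mul_add,
    Matrix.mul_assoc, Matrix.conjTranspose_conjTranspose]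
  abel

theorem norm_sampleCov_perturbation_le {N K L : ℕ} (hL : 0 < L) (A : Matrix (Fin N) (Fin K) ℂ)
    (S : Matrix (Fin K) (Fin L) ℂ) {σ : ℝ} {e : Fin N × Fin L → ℂ}
    (he : e ∈ noiseEvent S σ) :
    ‖(1 / (L : ℂ)) • (A * (S * (ofPairs e)ᴴ) + (A * (S * (ofPairs e)ᴴ))ᴴ
          + (ofPairs e * (ofPairs e)ᴴ - ((σ ^ 2 * L : ℝ) : ℂ) • (1 : Matrix (Fin N) (Fin N) ℂ)))‖
      ≤ 6 * σ * ‖A‖ * ‖sampleCov S‖ ^ (1 / 2 : ℝ) * √((N : ℝ) / L)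
        + 8 * σ ^ 2 * max √((N : ℝ) / L) ((N : ℝ) / L) := by
  obtain ⟨h1, h2⟩ := he
  have hL' : (0 : ℝ) < L := by exact_mod_cast hL
  have hSn : ‖S‖ = √L * ‖sampleCov S‖ ^ (1 / 2 : ℝ) := by
    rw [← Real.sqrt_eq_rpow, ← Real.sqrt_mul hL'.le, ← Real.sqrt_sq (norm_nonneg S)]
    congr 1
    rw [sq_l2_opNorm_eq_mul_conjTranspose, sampleCov, norm_smul]
    simp
    field_simp
  set m := max √((N : ℝ) / L) ((N : ℝ) / L)
  have h3 : ‖A * (S * (ofPairs e)ᴴ)‖ ≤ ‖A‖ * (σ * (3 * √N * ‖S‖)) :=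
    (Matrix.l2_opNorm_mul _ _).trans (by gcongr)
  have h4 : ‖A * (S * (ofPairs e)ᴴ) + (A * (S * (ofPairs e)ᴴ))ᴴ
          + (ofPairs e * (ofPairs e)ᴴ - ((σ ^ 2 * L : ℝ) : ℂ) • (1 : Matrix (Fin N) (Fin N) ℂ))‖
      ≤ ‖A‖ * (σ * (3 * √N * ‖S‖)) + ‖A‖ * (σ * (3 * √N * ‖S‖)) + σ ^ 2 * (8 * (L * m)) := by
    refine (norm_add₃_le).trans (add_le_add (add_le_add h3 ?_) h1)
    rwa [Matrix.l2_opNorm_conjTranspose]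
  rw [norm_smul]
  have h5 : ‖(1 / (L : ℂ))‖ = (L : ℝ)⁻¹ := by simp
  rw [h5]
  refine (mul_le_mul_of_nonneg_left h4 (by positivity)).trans (le_of_eq ?_)
  rw [hSn, Real.sqrt_div' _ hL'.le]
  have hsq : √(L : ℝ) ≠ 0 := (Real.sqrt_pos.2 hL').ne'
  have hLL : (L : ℝ) = √L * √L := (Real.mul_self_sqrt hL'.le).symm
  generalize √(L : ℝ) = q at *
  rw [hLL]
  field_simp
  ring

theorem subspaceDist_le_of_norm_le {N K : ℕ} (hK : 1 ≤ K)
    {A U Uhat : Matrix (Fin N) (Fin K) ℂ} (hU : IsOrthonormalBasisOfRange A U)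
    {Γ : Matrix (Fin K) (Fin K) ℂ} (hΓ : Γ.PosDef) {R D : Matrix (Fin N) (Fin N) ℂ} {τ η : ℝ}
    (hRM : R = A * Γ * Aᴴ + D + (τ : ℂ) • 1) (hUhat : IsLeadingEigenvectors R Uhat)
    (hD : ‖D‖ ≤ η)
    (hη : 2 * η ≤ singularValue A K ^ 2
      * eigenvalueDesc hΓ.isHermitian ⟨K - 1, Nat.sub_one_lt_of_lt hK⟩) :
    subspaceDist Uhat U ≤ 2 * η / (singularValue A K ^ 2
      * eigenvalueDesc hΓ.isHermitian ⟨K - 1, Nat.sub_one_lt_of_lt hK⟩) := by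
  obtain ⟨hKN, V, l, hV, hl, hR, rfl⟩ := hUhat
  have hs := singularValue_pos_of_isOrthonormalBasisOfRange hK hU
  have hlam := eigenvalueDesc_pos hΓ ⟨K - 1, Nat.sub_one_lt_of_lt hK⟩
  set lam := eigenvalueDesc hΓ.isHermitian ⟨K - 1, Nat.sub_one_lt_of_lt hK⟩ with hlamdef
  set δ := singularValue A K ^ 2 * lam with hδdef
  have hδ : 0 < δ := by positivity
  have hη0 : 0 ≤ η := (norm_nonneg D).trans hD
  obtain ⟨hUA, -⟩ := exists_eq_mul_of_isOrthonormalBasisOfRange hU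
  -- `G` is the signal covariance compressed to the signal subspace; its lower bound `δ` multiplies
  -- the bounds for `Γ` and for `Aᴴ` on that subspace.
  set G := Uᴴ * A * Γ * Aᴴ * U with hGdef
  have hGform : ∀ z, δ * ∑ i, ‖z i‖ ^ 2 ≤ (star z ⬝ᵥ G *ᵥ z).re := by
    intro z
    have h1 : star z ⬝ᵥ G *ᵥ z = star (Aᴴ *ᵥ U *ᵥ z) ⬝ᵥ Γ *ᵥ (Aᴴ *ᵥ U *ᵥ z) := by
      simp only [hGdef, Matrix.star_mulVec, Matrix.dotProduct_mulVec, Matrix.vecMul_vecMul,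
        Matrix.conjTranspose_conjTranspose, Matrix.mul_assoc]
    rw [h1]
    refine le_trans ?_ (eigenvalueDesc_mul_le hK hΓ.isHermitian _)
    rw [← hlamdef, hδdef, mul_comm (singularValue A K ^ 2), mul_assoc]
    exact mul_le_mul_of_nonneg_left (singularValue_sq_mul_le_of_mem_range hK hU z) hlam.le
  have hGherm : G.IsHermitian := by
    unfold Matrix.IsHermitian
    simp only [hGdef, Matrix.conjTranspose_mul, Matrix.conjTranspose_conjTranspose,
      hΓ.isHermitian.eq, Matrix.mul_assoc]
  have hGpos : G.PosDef := by
    refine Matrix.PosDef.of_dotProduct_mulVec_pos hGherm fun z hz => ?_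
    rw [Complex.lt_def]
    obtain ⟨i, hi⟩ := Function.ne_iff.1 hz
    have hzpos : 0 < ∑ i, ‖z i‖ ^ 2 := Finset.sum_pos' (fun _ _ => by positivity)
      ⟨i, Finset.mem_univ _, by have := norm_pos_iff.2 hi; positivity⟩
    refine ⟨(mul_pos hδ hzpos).trans_le (hGform z), ?_⟩
    obtain ⟨V', -, hV'⟩ := exists_spectral_of_isHermitian hGherm
    rw [star_dotProduct_mulVec_of_spectral hV']
    exact (Complex.ofReal_im _).symm
  have hM : A * Γ * Aᴴ = U * G * Uᴴ := by
    have h2 : Aᴴ * (U * Uᴴ) = Aᴴ := by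
      have := congrArg Matrix.conjTranspose hUA
      simpa [Matrix.conjTranspose_mul] using this
    calc A * Γ * Aᴴ = (U * Uᴴ * A) * Γ * (Aᴴ * (U * Uᴴ)) := by rw [hUA, h2]
      _ = U * G * Uᴴ := by simp only [hGdef, Matrix.mul_assoc]
  have hmain := norm_tailProj_mul_le hV hl hR hRM hU.1 hM hGpos hδ hGform hD
  refine (subspaceDist_le_norm_tailProj_mul hKN hV hU.1).trans ?_
  rw [le_div_iff₀ hδ]
  -- From `2 η ≤ δ` one has `δ / 2 ≤ δ - η`, so `‖P U‖ (δ - η) ≤ η` becomes `‖P U‖ δ ≤ 2 η`.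
  nlinarith [norm_nonneg (tailProj K V * U)]

end Esprit

theorem theorem9 {Ω : Type*} [MeasurableSpace Ω] (μ : Measure Ω) [IsProbabilityMeasure μ]
    {N K L : ℕ} (hK : 1 ≤ K) (hKN : K ≤ N)
    (f : Fin K → ℝ) (hf : ∀ k, f k ∈ Set.Ico (0 : ℝ) 1) (hf_inj : Function.Injective f)
    (S : Matrix (Fin K) (Fin L) ℂ) (hS : (Esprit.sampleCov S).PosDef)
    (σ : ℝ) (hσ : 0 ≤ σ)
    (E : Ω → Matrix (Fin N) (Fin L) ℂ) (hE : Esprit.IsIIDComplexGaussian μ σ E)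
    (U : Matrix (Fin N) (Fin K) ℂ)
    (hU : Esprit.IsOrthonormalBasisOfRange (Esprit.manifold N f) U)
    (Uhat : Ω → Matrix (Fin N) (Fin K) ℂ)
    (hUhat : ∀ ω, Esprit.IsLeadingEigenvectors
      (Esprit.sampleCov (Esprit.manifold N f * S + E ω)) (Uhat ω))
    (hbound : Esprit.errorBound hK (Esprit.manifold N f) S hS σ < 0.586) :
    Esprit.WithProbAtLeast μ (1 - 3 * Real.exp (-(N : ℝ) / 2)) fun ω =>
      Esprit.subspaceDist (Uhat ω) U ≤ Esprit.errorBound hK (Esprit.manifold N f) S hS σ := by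
  -- Positive definiteness with `K ≥ 1` excludes the degenerate cases `L = 0` and `S = 0`.
  have hSne : Esprit.sampleCov S ≠ 0 := by
    intro h
    have := Esprit.eigenvalueDesc_pos hS ⟨K - 1, Nat.sub_one_lt_of_lt hK⟩
    have h2 := Esprit.eigenvalueDesc_mul_le hK hS.isHermitian (Pi.single ⟨0, hK⟩ 1)
    have h3 : 0 < ∑ i, ‖(Pi.single (⟨0, hK⟩ : Fin K) (1 : ℂ) : Fin K → ℂ) i‖ ^ 2 :=
      Finset.sum_pos' (fun _ _ => by positivity) ⟨⟨0, hK⟩, Finset.mem_univ _, by simp⟩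
    have h4 : (star (Pi.single (⟨0, hK⟩ : Fin K) (1 : ℂ)) ⬝ᵥ Esprit.sampleCov S *ᵥ
        Pi.single (⟨0, hK⟩ : Fin K) (1 : ℂ)).re = 0 := by
      rw [h]; simp
    rw [h4] at h2
    exact absurd h2 (not_le.2 (mul_pos this h3))
  have hL : 0 < L := by
    refine Nat.pos_of_ne_zero fun h => hSne ?_
    simp [Esprit.sampleCov, h]
  have hSnorm : 0 < ‖S‖ := by
    rw [norm_pos_iff]
    rintro rfl
    exact hSne (by simp [Esprit.sampleCov])
  have hlaw : HasLaw (fun ω (p : Fin N × Fin L) => E ω p.1 p.2)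
      (Esprit.complexGaussianPi (Fin N × Fin L) σ) μ :=
    iIndepFun.hasLaw_pi (fun p => hE.2 p.1 p.2) hE.1
  let bad : Set Ω := {ω | (fun p : Fin N × Fin L => E ω p.1 p.2) ∈ (Esprit.noiseEvent S σ)ᶜ}
  have hbad : μ bad ≤ 3 * ENNReal.ofReal (Real.exp (-(N : ℝ) / 2)) := by
    refine le_trans (le_of_eq ?_)
      (Esprit.complexGaussianPi_compl_noiseEvent_le hKN hL S hSnorm hσ)
    exact hlaw.measure_eq (Esprit.measurableSet_noiseEvent S σ).compl
  -- The entries of `E` are only almost everywhere measurable, so `bad` is replaced by a measurable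
  -- superset of equal measure.
  refine ⟨(toMeasurable μ bad)ᶜ, (measurableSet_toMeasurable μ bad).compl, ?_, fun ω hω => ?_⟩
  · rw [probReal_compl_eq_one_sub (measurableSet_toMeasurable μ bad), measureReal_def,
      measure_toMeasurable]
    have h := ENNReal.toReal_mono (by finiteness) hbad
    rw [ENNReal.toReal_mul, ENNReal.toReal_ofReal (Real.exp_pos _).le] at h
    norm_num at h ⊢
    linarith
  · have hmem : (fun p : Fin N × Fin L => E ω p.1 p.2) ∈ Esprit.noiseEvent S σ := by
      by_contra h
      exact hω (subset_toMeasurable μ bad h)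
    have hofp : Esprit.ofPairs (fun p : Fin N × Fin L => E ω p.1 p.2) = E ω := rfl
    have hnorm := Esprit.norm_sampleCov_perturbation_le hL (Esprit.manifold N f) S hmem
    have hRM := Esprit.sampleCov_add_eq hL (Esprit.manifold N f) S (E ω) σ
    rw [hofp] at hnorm
    set η := 6 * σ * ‖Esprit.manifold N f‖ * ‖Esprit.sampleCov S‖ ^ (1 / 2 : ℝ) * √((N : ℝ) / L)
        + 8 * σ ^ 2 * max √((N : ℝ) / L) ((N : ℝ) / L) with hη
    have hδ : 0 < Esprit.singularValue (Esprit.manifold N f) K ^ 2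
        * Esprit.eigenvalueDesc hS.isHermitian ⟨K - 1, Nat.sub_one_lt_of_lt hK⟩ :=
      mul_pos (pow_pos (Esprit.singularValue_pos_of_isOrthonormalBasisOfRange hK hU) 2)
        (Esprit.eigenvalueDesc_pos hS _)
    have hB : Esprit.errorBound hK (Esprit.manifold N f) S hS σ
        = 2 * η / (Esprit.singularValue (Esprit.manifold N f) K ^ 2
          * Esprit.eigenvalueDesc hS.isHermitian ⟨K - 1, Nat.sub_one_lt_of_lt hK⟩) := by
      rw [Esprit.errorBound, hη]
      congr 1
      ring
    rw [hB] at hbound ⊢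
    rw [div_lt_iff₀ hδ] at hbound
    -- The hypothesis `B < 0.586` enters as `2 η < 0.586 δ ≤ δ`.
    exact Esprit.subspaceDist_le_of_norm_le hK hU hS hRM (hUhat ω) hnorm (by linarith)
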